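/- Let $\mu\in\mathbb R$ and let $u_0:\mathbb R\to\mathbb C$ be a bounded $C^3$ function whose derivatives $u_0',u_0'',u_0'''$ belong to $L^2(\mathbb R)$. For $0<h\le 1$ let $(x_n)_{n\in\mathbb Z}$ be a lattice of spacing $h$, that is, $x_n=x_{n-1}+h$ for all $n\in\mathbb Z$, and let $u=(u_n(t))_{n\in\mathbb Z}$ and $U=(U_n(t))_{n\in\mathbb Z}$ be solutions, bounded on $[0,\tau]\times\mathbb Z$ for some $\tau=\tau_h$ (the bound may depend on $h$), of the Ablowitz–Ladik equation $$ i\frac{du_n}{dt}+\frac{1}{h^{2}}\left(u_{n+1}+u_{n-1}-2u_n\right)+\frac{\mu}{2}|u_n|^2\left(u_{n+1}+u_{n-1}\right)=0,\qquad n\in\mathbb Z,\ 0<t<\tau, $$ and of the discrete nonlinear Schrödinger equation $$ i\frac{dU_n}{dt}+\frac{1}{h^{2}}\left(U_{n+1}+U_{n-1}-2U_n\right)+\mu|U_n|^2U_n=0,\qquad n\in\mathbb Z,\ 0<t<\tau, $$ with the same sampled initial data $u_n(0)=U_n(0)=u_0(x_n)$, all components being continuous on $[0,\tau]$. Then there are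 $T>0$ and $C>0$, depending only on $\mu$ and $u_0$ (in particular not on $h$, on the position of the lattice, or on $\tau$), such that for all $0<h\le1$ and all $t\in[0,T]$ with $t\le\tau$, $$ \|u(t)-U(t)\|_{\ell^\infty}=\sup_{n\in\mathbb Z}|u_n(t)-U_n(t)|\le C\,h^2\,t . $$ -/

import Mathlib

/-- The discrete Laplacian `(Δu)_n = u_{n+1} + u_{n-1} - 2 u_n` on the infinite lattice. -/
def discreteLaplacian (u : ℤ → ℂ) (n : ℤ) : ℂ :=
  u (n + 1) + u (n - 1) - 2 * u n

/-- `u : time → lattice → ℂ` is a bounded solution on `[0, τ]` of the lattice equation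
`i u_n' + κ (Δu)_n + N(u)_n = 0`, `n ∈ ℤ`: every component is continuous on `[0, τ]`, the equation
holds for `0 < t < τ`, and `u` is bounded on `[0, τ] × ℤ`. -/
structure IsBoundedLatticeSolution (κ : ℝ) (N : (ℤ → ℂ) → ℤ → ℂ) (τ : ℝ) (u : ℝ → ℤ → ℂ) :
    Prop where
  continuousOn : ∀ n : ℤ, ContinuousOn (fun t => u t n) (Set.Icc 0 τ)
  equation : ∀ n : ℤ, ∀ t ∈ Set.Ioo 0 τ, ∃ d : ℂ, HasDerivAt (fun s => u s n) d t ∧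
    Complex.I * d + (κ : ℂ) * discreteLaplacian (u t) n + N (u t) n = 0
  bounded : ∃ M : ℝ, ∀ t ∈ Set.Icc 0 τ, ∀ n : ℤ, ‖u t n‖ ≤ M

/-- The Ablowitz-Ladik nonlinearity `(μ/2) |u_n|² (u_{n+1} + u_{n-1})`. -/
noncomputable def alNonlinearity (μ : ℝ) (u : ℤ → ℂ) (n : ℤ) : ℂ :=
  (μ : ℂ) / 2 * (‖u n‖ : ℂ) ^ 2 * (u (n + 1) + u (n - 1))

/-- The cubic on-site nonlinearity `μ |u_n|² u_n`. -/
noncomputable def dnlsNonlinearity (μ : ℝ) (u : ℤ → ℂ) (n : ℤ) : ℂ :=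
  (μ : ℂ) * (‖u n‖ : ℂ) ^ 2 * u n

/-- Bounded solutions on `[0, τ]` of the Ablowitz-Ladik equation with lattice spacing `h`:
`i u_n' + h⁻² (Δu)_n + (μ/2) |u_n|² (u_{n+1} + u_{n-1}) = 0`. -/
def IsALSolution (μ h τ : ℝ) (u : ℝ → ℤ → ℂ) : Prop :=
  IsBoundedLatticeSolution ((h ^ 2)⁻¹) (alNonlinearity μ) τ u

/-- Bounded solutions on `[0, τ]` of the DNLS equation with lattice spacing `h`:
`i U_n' + h⁻² (ΔU)_n + μ |U_n|² U_n = 0`. -/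
def IsDNLSSolution (μ h τ : ℝ) (U : ℝ → ℤ → ℂ) : Prop :=
  IsBoundedLatticeSolution ((h ^ 2)⁻¹) (dnlsNonlinearity μ) τ U

/-! The Ablowitz–Ladik nonlinearity is the cubic one with `u n` replaced by the average of its two
neighbours, an error of `h²/2` times the second difference quotient of `u`. If `u` and `U` stay
smooth uniformly in `h`, then `φ = u - U` solves a linear-type lattice Schrödinger equation with
zero data and a forcing of size `O(h²)` plus a Lipschitz term in `φ`. A short-time `H¹` estimate
then gives `O(h² t)`, and the discrete Sobolev embedding turns it into a sup bound.

The data need not decay, so smoothness is measured in a Zhidkov norm: the sup of `u` and the `L²`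
norms of three difference quotients. This norm is an algebra uniformly in `h` (`ZhidkovLe.mul`), it
controls sampled data (`exists_zhidkovLe_sample`), and a bootstrap propagates it on a time interval
independent of `h` (`zhidkovLe_two_mul`).

The analytic core is `LatticeFlow.l2_le`, an `L²` estimate for solutions assumed only bounded. Their
energy may be infinite a priori, so it is computed with a slowly decaying weight, which is then
removed. The conclusion for `φ` is `norm_sub_le_of_zhidkovLe`. -/

open Set Filter Topology

/-! ### Discrete `L²` bounds and the Sobolev embedding. -/

/-- The forward difference quotient `(u_{n+1} - u_n) / h`. -/
noncomputable def latticeDiff (h : ℝ) (a : ℤ → ℂ) (n : ℤ) : ℂ := (a (n + 1) - a n) / h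

/-- The weighted norm `(h ∑ |a_n|²)^{1/2}` is finite and at most `A`. -/
structure LatticeL2Le (h : ℝ) (a : ℤ → ℂ) (A : ℝ) : Prop where
  nonneg : 0 ≤ A
  sum_le : ∀ s : Finset ℤ, h * ∑ n ∈ s, ‖a n‖ ^ 2 ≤ A ^ 2

namespace LatticeL2Le

variable {h A B : ℝ} {a b : ℤ → ℂ}

theorem mono (ha : LatticeL2Le h a A) (hAB : A ≤ B) : LatticeL2Le h a B :=
  ⟨ha.nonneg.trans hAB, fun s => (ha.sum_le s).trans (by have := ha.nonneg; gcongr)⟩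

theorem of_norm_le (hh : 0 ≤ h) {c : ℝ} (hc : 0 ≤ c) (hb : LatticeL2Le h b B)
    (hab : ∀ n, ‖a n‖ ≤ c * ‖b n‖) : LatticeL2Le h a (c * B) := by
  refine ⟨mul_nonneg hc hb.nonneg, fun s => ?_⟩
  calc h * ∑ n ∈ s, ‖a n‖ ^ 2 ≤ h * ∑ n ∈ s, (c * ‖b n‖) ^ 2 := by
        gcongr with n _; exact hab n
    _ = c ^ 2 * (h * ∑ n ∈ s, ‖b n‖ ^ 2) := by
        simp only [mul_pow, ← Finset.mul_sum]; ring
    _ ≤ c ^ 2 * B ^ 2 := by gcongr; exact hb.sum_le s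
    _ = (c * B) ^ 2 := by ring

theorem zero (h : ℝ) : LatticeL2Le h (fun _ => 0) 0 := ⟨le_rfl, by simp⟩

theorem add (hh : 0 ≤ h) (ha : LatticeL2Le h a A) (hb : LatticeL2Le h b B) :
    LatticeL2Le h (fun n => a n + b n) (A + B) := by
  have hA := ha.nonneg
  have hB := hb.nonneg
  refine ⟨by positivity, fun s => ?_⟩
  have h1 := ha.sum_le s
  have h2 := hb.sum_le s
  have h3 : h * ∑ n ∈ s, ‖a n‖ * ‖b n‖ ≤ A * B := by
    refine abs_le_of_sq_le_sq' ?_ (by positivity) |>.2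
    have := Finset.sum_mul_sq_le_sq_mul_sq s (fun n => ‖a n‖) (fun n => ‖b n‖)
    calc (h * ∑ n ∈ s, ‖a n‖ * ‖b n‖) ^ 2 = h ^ 2 * (∑ n ∈ s, ‖a n‖ * ‖b n‖) ^ 2 := by ring
      _ ≤ h ^ 2 * ((∑ n ∈ s, ‖a n‖ ^ 2) * ∑ n ∈ s, ‖b n‖ ^ 2) := by gcongr
      _ = (h * ∑ n ∈ s, ‖a n‖ ^ 2) * (h * ∑ n ∈ s, ‖b n‖ ^ 2) := by ring
      _ ≤ A ^ 2 * B ^ 2 := by gcongr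
      _ = (A * B) ^ 2 := by ring
  calc h * ∑ n ∈ s, ‖a n + b n‖ ^ 2 ≤ h * ∑ n ∈ s, (‖a n‖ + ‖b n‖) ^ 2 := by
        gcongr with n _; exact norm_add_le _ _
    _ = h * ∑ n ∈ s, ‖a n‖ ^ 2 + 2 * (h * ∑ n ∈ s, ‖a n‖ * ‖b n‖)
          + h * ∑ n ∈ s, ‖b n‖ ^ 2 := by
        have : ∀ n, (‖a n‖ + ‖b n‖) ^ 2 = ‖a n‖ ^ 2 + 2 * (‖a n‖ * ‖b n‖) + ‖b n‖ ^ 2 :=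
          fun n => by ring
        simp only [this, Finset.sum_add_distrib, ← Finset.mul_sum]; ring
    _ ≤ A ^ 2 + 2 * (A * B) + B ^ 2 := by gcongr
    _ = (A + B) ^ 2 := by ring

theorem sum_comp_le {ι : Type*} (ha : LatticeL2Le h a A) {e : ι → ℤ}
    (he : Function.Injective e) (s : Finset ι) : h * ∑ i ∈ s, ‖a (e i)‖ ^ 2 ≤ A ^ 2 := by
  have := ha.sum_le (s.map ⟨e, he⟩)
  rwa [Finset.sum_map] at this

theorem shift (ha : LatticeL2Le h a A) (k : ℤ) : LatticeL2Le h (fun n => a (n + k)) A :=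
  ⟨ha.nonneg, fun s => ha.sum_comp_le (add_left_injective k) s⟩

theorem mul_of_norm_le_left (hh : 0 ≤ h) (ha : ∀ n, ‖a n‖ ≤ A) (hb : LatticeL2Le h b B) :
    LatticeL2Le h (fun n => a n * b n) (A * B) :=
  of_norm_le hh ((norm_nonneg _).trans (ha 0)) hb fun n => by
    rw [norm_mul]; gcongr; exact ha n

theorem mul_of_norm_le_right (hh : 0 ≤ h) (ha : LatticeL2Le h a A) (hb : ∀ n, ‖b n‖ ≤ B) :
    LatticeL2Le h (fun n => a n * b n) (A * B) := by
  simpa only [mul_comm] using mul_of_norm_le_left hh hb ha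

theorem const_mul (hh : 0 ≤ h) (c : ℂ) (ha : LatticeL2Le h a A) :
    LatticeL2Le h (fun n => c * a n) (‖c‖ * A) :=
  mul_of_norm_le_left hh (fun _ => le_rfl) ha

theorem conj (ha : LatticeL2Le h a A) :
    LatticeL2Le h (fun n => starRingEnd ℂ (a n)) A :=
  ⟨ha.nonneg, fun s => by simpa using ha.sum_le s⟩

/-- An inverse inequality that loses a factor `1/h`. It serves only to show that norms are finite at
fixed mesh size, never in a uniform estimate. -/
theorem latticeDiff (hh : 0 < h) (ha : LatticeL2Le h a A) :
    LatticeL2Le h (latticeDiff h a) (h⁻¹ * (A + A)) := by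
  have h1 := ((ha.shift 1).add hh.le (ha.const_mul hh.le (-1))).const_mul hh.le ((h : ℂ)⁻¹)
  have e : ‖((h : ℂ)⁻¹)‖ = h⁻¹ := by simp [abs_of_pos hh]
  rw [e] at h1
  refine (h1.mono ?_).of_norm_le hh.le zero_le_one (b := fun n => (h : ℂ)⁻¹ * (a (n + 1) + -1 * a n))
    (fun n => ?_) |>.mono (one_mul _).le
  · simp
  · rw [one_mul]; apply le_of_eq; congr 1; unfold _root_.latticeDiff; ring

/-- Discrete Sobolev embedding of `H¹` into `ℓ^∞`. -/
theorem norm_le (hh : 0 < h) (ha : LatticeL2Le h a A) (hd : LatticeL2Le h (_root_.latticeDiff h a) A)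
    (n : ℤ) : ‖a n‖ ≤ 2 * A := by
  have hA := ha.nonneg
  -- Telescoping of `p² - q² ≤ h d (p + q) ≤ h d² + h (p² + q²) / 2` over neighbouring sites.
  have key : ∀ j : ℕ, ‖a n‖ ^ 2 ≤ ‖a (n - j)‖ ^ 2 +
      ∑ i ∈ Finset.range j, (h * ‖_root_.latticeDiff h a (n - i - 1)‖ ^ 2 +
        (h * ‖a (n - i)‖ ^ 2 + h * ‖a (n - i - 1)‖ ^ 2) / 2) := by
    intro j
    induction j with
    | zero => simp
    | succ j ih =>
      rw [Finset.sum_range_succ]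
      have e : a (n - j) = a (n - j - 1) + h * _root_.latticeDiff h a (n - j - 1) := by
        unfold _root_.latticeDiff
        have : (h : ℂ) ≠ 0 := by exact_mod_cast hh.ne'
        rw [sub_add_cancel]; field_simp; ring
      have e2 : (n : ℤ) - ((j + 1 : ℕ) : ℤ) = n - j - 1 := by push_cast; ring
      rw [e2]
      have h1 : ‖a (n - j)‖ ≤ ‖a (n - j - 1)‖ + h * ‖_root_.latticeDiff h a (n - j - 1)‖ := by
        conv_lhs => rw [e]
        refine (norm_add_le _ _).trans ?_
        simp [abs_of_pos hh]
      set p := ‖a (n - j)‖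
      set q := ‖a (n - j - 1)‖
      set d := ‖_root_.latticeDiff h a (n - j - 1)‖
      have hp : 0 ≤ p := norm_nonneg _
      have hq : 0 ≤ q := norm_nonneg _
      have h2 : p ^ 2 ≤ q ^ 2 + (h * d ^ 2 + (h * p ^ 2 + h * q ^ 2) / 2) := by
        have : (p - q) * (p + q) ≤ (h * d) * (p + q) := by gcongr; linarith
        nlinarith [mul_nonneg hh.le (sq_nonneg (2 * d - (p + q))), mul_nonneg hh.le (sq_nonneg (p - q))]
      linarith
  have bnd : ∀ j : ℕ, ‖a n‖ ^ 2 ≤ ‖a (n - j)‖ ^ 2 + 2 * A ^ 2 := by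
    intro j
    refine (key j).trans ?_
    have i1 := hd.sum_comp_le (e := fun i : ℕ => n - i - 1) (fun i k hik => by simpa using hik)
      (Finset.range j)
    have i2 := ha.sum_comp_le (e := fun i : ℕ => n - i) (fun i k hik => by simpa using hik)
      (Finset.range j)
    have i3 := ha.sum_comp_le (e := fun i : ℕ => n - i - 1) (fun i k hik => by simpa using hik)
      (Finset.range j)
    rw [Finset.sum_add_distrib, ← Finset.sum_div, Finset.sum_add_distrib, ← Finset.mul_sum,
      ← Finset.mul_sum, ← Finset.mul_sum]
    linarith
  -- Averaging over at least `1/h` sites absorbs the remaining value at `n - j`. This gives `‖a n‖²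
  -- ≤ 3 A²`, within the claimed `(2A)²`.
  obtain ⟨N, hN⟩ := exists_nat_gt h⁻¹
  have hN1 : 1 ≤ h * N := by
    have := mul_lt_mul_of_pos_left hN hh
    rw [mul_inv_cancel₀ hh.ne'] at this; exact this.le
  have i4 := ha.sum_comp_le (e := fun i : ℕ => n - i) (fun i k hik => by simpa using hik)
      (Finset.range N)
  have i5 : ∑ j ∈ Finset.range N, (‖a n‖ ^ 2 - 2 * A ^ 2) ≤
      ∑ j ∈ Finset.range N, ‖a (n - j)‖ ^ 2 :=
    Finset.sum_le_sum fun j _ => by linarith [bnd j]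
  simp only [Finset.sum_const, Finset.card_range, nsmul_eq_mul] at i5
  have i6 : (h * N) * (‖a n‖ ^ 2 - 2 * A ^ 2) ≤ A ^ 2 := by
    calc _ = h * (N * (‖a n‖ ^ 2 - 2 * A ^ 2)) := by ring
      _ ≤ _ := (mul_le_mul_of_nonneg_left i5 hh.le).trans i4
  refine abs_le_of_sq_le_sq' ?_ (by positivity) |>.2
  by_contra hcon
  push Not at hcon
  nlinarith [sq_nonneg A]

end LatticeL2Le

/-! ### Product estimates in the discrete Zhidkov and Sobolev spaces. -/

theorem latticeDiff_add (h : ℝ) (a b : ℤ → ℂ) :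
    latticeDiff h (fun n => a n + b n) = fun n => latticeDiff h a n + latticeDiff h b n := by
  funext n; simp only [latticeDiff]; ring

theorem latticeDiff_const_mul (h : ℝ) (c : ℂ) (a : ℤ → ℂ) :
    latticeDiff h (fun n => c * a n) = fun n => c * latticeDiff h a n := by
  funext n; simp only [latticeDiff]; ring

theorem latticeDiff_shift (h : ℝ) (a : ℤ → ℂ) (k : ℤ) :
    latticeDiff h (fun n => a (n + k)) = fun n => latticeDiff h a (n + k) := by
  funext n; simp only [latticeDiff, add_right_comm]

theorem latticeDiff_conj (h : ℝ) (a : ℤ → ℂ) :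
    latticeDiff h (fun n => starRingEnd ℂ (a n)) = fun n => starRingEnd ℂ (latticeDiff h a n) := by
  funext n; simp [latticeDiff]

theorem latticeDiff_mul (h : ℝ) (a b : ℤ → ℂ) :
    latticeDiff h (fun n => a n * b n) =
      fun n => latticeDiff h a n * b (n + 1) + a n * latticeDiff h b n := by
  funext n; simp only [latticeDiff]; ring

/-- `a` is bounded by `A`, and so are the `L²` norms of its first three difference quotients. -/
structure ZhidkovLe (h : ℝ) (a : ℤ → ℂ) (A : ℝ) : Prop where
  norm_le : ∀ n, ‖a n‖ ≤ A
  diff1 : LatticeL2Le h (latticeDiff h a) A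
  diff2 : LatticeL2Le h (latticeDiff h (latticeDiff h a)) A
  diff3 : LatticeL2Le h (latticeDiff h (latticeDiff h (latticeDiff h a))) A

namespace ZhidkovLe

variable {h A B : ℝ} {a b : ℤ → ℂ}

theorem nonneg (ha : ZhidkovLe h a A) : 0 ≤ A := ha.diff1.nonneg

theorem mono (ha : ZhidkovLe h a A) (hAB : A ≤ B) : ZhidkovLe h a B :=
  ⟨fun n => (ha.norm_le n).trans hAB, ha.diff1.mono hAB, ha.diff2.mono hAB, ha.diff3.mono hAB⟩

theorem add (hh : 0 ≤ h) (ha : ZhidkovLe h a A) (hb : ZhidkovLe h b B) :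
    ZhidkovLe h (fun n => a n + b n) (A + B) := by
  refine ⟨fun n => (norm_add_le _ _).trans (add_le_add (ha.norm_le n) (hb.norm_le n)), ?_, ?_, ?_⟩
  all_goals simp only [latticeDiff_add]
  exacts [ha.diff1.add hh hb.diff1, ha.diff2.add hh hb.diff2, ha.diff3.add hh hb.diff3]

theorem const_mul (hh : 0 ≤ h) (c : ℂ) (ha : ZhidkovLe h a A) :
    ZhidkovLe h (fun n => c * a n) (‖c‖ * A) := by
  refine ⟨fun n => by rw [norm_mul]; gcongr; exact ha.norm_le n, ?_, ?_, ?_⟩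
  all_goals simp only [latticeDiff_const_mul]
  exacts [ha.diff1.const_mul hh c, ha.diff2.const_mul hh c, ha.diff3.const_mul hh c]

theorem shift (ha : ZhidkovLe h a A) (k : ℤ) : ZhidkovLe h (fun n => a (n + k)) A := by
  refine ⟨fun n => ha.norm_le _, ?_, ?_, ?_⟩
  · rw [latticeDiff_shift]; exact ha.diff1.shift k
  · rw [latticeDiff_shift, latticeDiff_shift]; exact ha.diff2.shift k
  · rw [latticeDiff_shift, latticeDiff_shift, latticeDiff_shift]; exact ha.diff3.shift k

theorem conj (ha : ZhidkovLe h a A) : ZhidkovLe h (fun n => starRingEnd ℂ (a n)) A := by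
  refine ⟨fun n => by simpa using ha.norm_le n, ?_, ?_, ?_⟩
  all_goals simp only [latticeDiff_conj]
  exacts [ha.diff1.conj, ha.diff2.conj, ha.diff3.conj]

theorem norm_diff1_le (hh : 0 < h) (ha : ZhidkovLe h a A) (n : ℤ) :
    ‖latticeDiff h a n‖ ≤ 2 * A := ha.diff1.norm_le hh ha.diff2 n

theorem norm_diff2_le (hh : 0 < h) (ha : ZhidkovLe h a A) (n : ℤ) :
    ‖latticeDiff h (latticeDiff h a) n‖ ≤ 2 * A := ha.diff2.norm_le hh ha.diff3 n

/-- Leibniz rule, with one factor of each term in `L²` and the other in sup norm. The Sobolev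
embedding costs a factor 2 on first and second quotients, so the third quotient gives the worst
constant, `1 + 3·2 + 3·2 + 1 = 14`. -/
theorem mul (hh : 0 < h) (ha : ZhidkovLe h a A) (hb : ZhidkovLe h b B) :
    ZhidkovLe h (fun n => a n * b n) (14 * (A * B)) := by
  have hA := ha.nonneg
  have hB := hb.nonneg
  have hAB : 0 ≤ A * B := by positivity
  refine ⟨fun n => ?_, ?_, ?_, ?_⟩
  · rw [norm_mul]
    have := mul_le_mul (ha.norm_le n) (hb.norm_le n) (norm_nonneg _) hA
    linarith
  · rw [latticeDiff_mul]
    refine ((ha.diff1.mul_of_norm_le_right hh.le fun n => hb.norm_le (n + 1)).add hh.le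
      (hb.diff1.mul_of_norm_le_left hh.le ha.norm_le)).mono (by linarith)
  · have e : latticeDiff h (latticeDiff h (fun n => a n * b n)) = fun n =>
        latticeDiff h (latticeDiff h a) n * b (n + 1 + 1) +
        2 * (latticeDiff h a n * latticeDiff h b (n + 1)) +
        a n * latticeDiff h (latticeDiff h b) n := by
      funext n; simp only [latticeDiff]; ring
    rw [e]
    refine (((ha.diff2.mul_of_norm_le_right hh.le fun n => hb.norm_le (n + 1 + 1)).add hh.le
      ((ha.diff1.mul_of_norm_le_right hh.le
        fun n => hb.norm_diff1_le hh (n + 1)).const_mul hh.le 2)).add hh.le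
      (hb.diff2.mul_of_norm_le_left hh.le ha.norm_le)).mono ?_
    simp only [Complex.norm_ofNat]; linarith
  · have e : latticeDiff h (latticeDiff h (latticeDiff h (fun n => a n * b n))) = fun n =>
        latticeDiff h (latticeDiff h (latticeDiff h a)) n * b (n + 1 + 1 + 1) +
        3 * (latticeDiff h (latticeDiff h a) n * latticeDiff h b (n + 1 + 1)) +
        3 * (latticeDiff h a n * latticeDiff h (latticeDiff h b) (n + 1)) +
        a n * latticeDiff h (latticeDiff h (latticeDiff h b)) n := by
      funext n; simp only [latticeDiff]; ring
    rw [e]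
    refine ((((ha.diff3.mul_of_norm_le_right hh.le fun n => hb.norm_le (n + 1 + 1 + 1)).add hh.le
      ((ha.diff2.mul_of_norm_le_right hh.le
        fun n => hb.norm_diff1_le hh (n + 1 + 1)).const_mul hh.le 3)).add hh.le
      ((ha.diff1.mul_of_norm_le_right hh.le
        fun n => hb.norm_diff2_le hh (n + 1)).const_mul hh.le 3)).add hh.le
      (hb.diff3.mul_of_norm_le_left hh.le ha.norm_le)).mono ?_
    simp only [Complex.norm_ofNat]; linarith

end ZhidkovLe

/-- The `L²` norms of `a` and of its difference quotient are at most `A`. -/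
structure SobolevLe (h : ℝ) (a : ℤ → ℂ) (A : ℝ) : Prop where
  diff0 : LatticeL2Le h a A
  diff1 : LatticeL2Le h (latticeDiff h a) A

namespace SobolevLe

variable {h A B : ℝ} {a b : ℤ → ℂ}

theorem nonneg (ha : SobolevLe h a A) : 0 ≤ A := ha.diff0.nonneg

theorem mono (ha : SobolevLe h a A) (hAB : A ≤ B) : SobolevLe h a B :=
  ⟨ha.diff0.mono hAB, ha.diff1.mono hAB⟩

theorem norm_le (hh : 0 < h) (ha : SobolevLe h a A) (n : ℤ) : ‖a n‖ ≤ 2 * A :=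
  ha.diff0.norm_le hh ha.diff1 n

theorem add (hh : 0 ≤ h) (ha : SobolevLe h a A) (hb : SobolevLe h b B) :
    SobolevLe h (fun n => a n + b n) (A + B) := by
  refine ⟨ha.diff0.add hh hb.diff0, ?_⟩
  rw [latticeDiff_add]; exact ha.diff1.add hh hb.diff1

theorem const_mul (hh : 0 ≤ h) (c : ℂ) (ha : SobolevLe h a A) :
    SobolevLe h (fun n => c * a n) (‖c‖ * A) := by
  refine ⟨ha.diff0.const_mul hh c, ?_⟩
  rw [latticeDiff_const_mul]; exact ha.diff1.const_mul hh c

theorem shift (ha : SobolevLe h a A) (k : ℤ) : SobolevLe h (fun n => a (n + k)) A := by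
  refine ⟨ha.diff0.shift k, ?_⟩
  rw [latticeDiff_shift]; exact ha.diff1.shift k

theorem conj (ha : SobolevLe h a A) : SobolevLe h (fun n => starRingEnd ℂ (a n)) A := by
  refine ⟨ha.diff0.conj, ?_⟩
  rw [latticeDiff_conj]; exact ha.diff1.conj

theorem zhidkov_mul (hh : 0 < h) (ha : ZhidkovLe h a A) (hb : SobolevLe h b B) :
    SobolevLe h (fun n => a n * b n) (3 * (A * B)) := by
  have hAB : 0 ≤ A * B := mul_nonneg ha.nonneg hb.nonneg
  refine ⟨(hb.diff0.mul_of_norm_le_left hh.le ha.norm_le).mono (by linarith), ?_⟩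
  rw [latticeDiff_mul]
  exact ((ha.diff1.mul_of_norm_le_right hh.le fun n => hb.norm_le hh (n + 1)).add hh.le
    (hb.diff1.mul_of_norm_le_left hh.le ha.norm_le)).mono (by linarith)

end SobolevLe

/-! ### The `L²` estimate for lattice flows, by weighted energies. -/

/-- The free parameter `l` comes from Young's inequality. Optimising it at each time gives the
linear inequality `y' ≤ (a/2) y + G` for `y = √(E + δ²)`, hence growth linear in `G`; the shift by
`δ²` keeps the root differentiable. -/
theorem sqrt_gronwall {E E' : ℝ → ℝ} {a G δ t₀ t₁ : ℝ} (ha : 0 ≤ a) (hG : 0 < G) (hδ : 0 < δ)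
    (hc : ContinuousOn E (Icc t₀ t₁)) (hE : ∀ t, 0 ≤ E t)
    (hd : ∀ t ∈ Ioo t₀ t₁, HasDerivAt E (E' t) t)
    (hb : ∀ t ∈ Ioo t₀ t₁, ∀ l : ℝ, 0 < l → E' t ≤ (a + l) * E t + l⁻¹ * G ^ 2)
    {t : ℝ} (ht : t ∈ Icc t₀ t₁) :
    √(E t + δ ^ 2) ≤ Real.exp (a / 2 * (t - t₀)) * (√(E t₀ + δ ^ 2) + (t - t₀) * G) := by
  have hpos : ∀ t, 0 < E t + δ ^ 2 := fun t => by have := hE t; positivity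
  have hy : ∀ t ∈ Ioo t₀ t₁, HasDerivAt (fun s => √(E s + δ ^ 2))
      (E' t / (2 * √(E t + δ ^ 2))) t := fun t ht =>
    ((hd t ht).add_const _).sqrt (hpos t).ne'
  have hbd : ∀ t ∈ Ioo t₀ t₁, E' t / (2 * √(E t + δ ^ 2)) ≤ a / 2 * √(E t + δ ^ 2) + G := by
    intro t ht
    have hyp : 0 < √(E t + δ ^ 2) := Real.sqrt_pos.2 (hpos t)
    have hsq : √(E t + δ ^ 2) ^ 2 = E t + δ ^ 2 := Real.sq_sqrt (hpos t).le
    set y := √(E t + δ ^ 2)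
    have h1 := hb t ht (G / y) (by positivity)
    have hEy : E t ≤ y ^ 2 := by rw [hsq]; nlinarith
    have h2 : (a + G / y) * E t ≤ (a + G / y) * y ^ 2 := by gcongr
    rw [div_le_iff₀ (by positivity)]
    have e1 : (a + G / y) * y ^ 2 = a * y ^ 2 + G * y := by field_simp
    have e2 : (G / y)⁻¹ * G ^ 2 = G * y := by field_simp
    nlinarith
  have hψ : ∀ t ∈ Ioo t₀ t₁, HasDerivAt
      (fun s => Real.exp (-(a / 2 * (s - t₀))) * √(E s + δ ^ 2) - (s - t₀) * G)
      (Real.exp (-(a / 2 * (t - t₀))) * (-(a / 2 * 1)) * √(E t + δ ^ 2) +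
        Real.exp (-(a / 2 * (t - t₀))) * (E' t / (2 * √(E t + δ ^ 2))) - 1 * G) t := by
    intro t ht
    have h1 : HasDerivAt (fun s : ℝ => s - t₀) 1 t := (hasDerivAt_id t).sub_const t₀
    exact (((h1.const_mul (a / 2)).neg.exp).mul (hy t ht)).sub (h1.mul_const G)
  have hanti : AntitoneOn
      (fun s => Real.exp (-(a / 2 * (s - t₀))) * √(E s + δ ^ 2) - (s - t₀) * G) (Icc t₀ t₁) := by
    refine antitoneOn_of_deriv_nonpos (convex_Icc _ _) ?_ ?_ ?_
    · refine ContinuousOn.sub (ContinuousOn.mul (by fun_prop) ?_) (by fun_prop)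
      exact (hc.add continuousOn_const).sqrt
    · rw [interior_Icc]; exact fun t ht => (hψ t ht).differentiableAt.differentiableWithinAt
    · rw [interior_Icc]
      intro t ht
      rw [(hψ t ht).deriv]
      have h0 : 0 ≤ a / 2 * (t - t₀) := by
        have : t₀ < t := ht.1
        have : 0 ≤ t - t₀ := by linarith
        positivity
      have h1 : Real.exp (-(a / 2 * (t - t₀))) ≤ 1 := Real.exp_le_one_iff.2 (by linarith)
      have h2 := hbd t ht
      have h3 : 0 < Real.exp (-(a / 2 * (t - t₀))) := Real.exp_pos _
      have h4 := mul_le_mul_of_nonneg_left h2 h3.le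
      nlinarith
  have h1 := hanti (left_mem_Icc.2 (ht.1.trans ht.2)) ht ht.1
  simp only [sub_self, mul_zero, neg_zero, Real.exp_zero, one_mul, zero_mul, sub_zero] at h1
  have h3 : 0 < Real.exp (a / 2 * (t - t₀)) := Real.exp_pos _
  calc √(E t + δ ^ 2)
      = Real.exp (a / 2 * (t - t₀)) * (Real.exp (-(a / 2 * (t - t₀))) * √(E t + δ ^ 2)) := by
        rw [← mul_assoc, ← Real.exp_add]; simp
    _ ≤ _ := by gcongr; linarith

/-- `w` is a bounded solution on `[t₀, t₁]` of `w_n' = i κ (Δ w)_n + f_n`. -/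
structure LatticeFlow (κ : ℝ) (f : ℝ → ℤ → ℂ) (t₀ t₁ : ℝ) (w : ℝ → ℤ → ℂ) : Prop where
  cont : ∀ n, ContinuousOn (fun t => w t n) (Icc t₀ t₁)
  deriv : ∀ n, ∀ t ∈ Ioo t₀ t₁, HasDerivAt (fun s => w s n)
    (Complex.I * (κ * discreteLaplacian (w t) n) + f t n) t
  bdd : ∃ M, ∀ t ∈ Icc t₀ t₁, ∀ n, ‖w t n‖ ≤ M

/-- A positive summable weight on `ℤ` whose neighbouring values differ at most by a factor `q`. -/
structure IsSlowWeight (q : ℝ) (ρ : ℤ → ℝ) : Prop where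
  pos : ∀ n, 0 < ρ n
  le_one : ∀ n, ρ n ≤ 1
  summable : Summable ρ
  le_succ : ∀ n, ρ n ≤ q * ρ (n + 1)
  succ_le : ∀ n, ρ (n + 1) ≤ q * ρ n

/-- The weight makes the energy of a bounded sequence finite, while its commutator with the
Laplacian is `O(δ)` and vanishes in the limit. -/
theorem isSlowWeight_pow {δ : ℝ} (hδ : 0 < δ) :
    IsSlowWeight (1 + δ) (fun n : ℤ => ((1 + δ)⁻¹) ^ n.natAbs) := by
  have h1 : (1 + δ)⁻¹ < 1 := inv_lt_one_of_one_lt₀ (by linarith)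
  have h0 : 0 < (1 + δ)⁻¹ := by positivity
  have hs : ∀ k : ℕ, ((1 + δ)⁻¹) ^ k = (1 + δ) * ((1 + δ)⁻¹) ^ (k + 1) := by
    intro k; rw [pow_succ]; field_simp
  have key : ∀ k l : ℕ, l ≤ k + 1 → ((1 + δ)⁻¹) ^ k ≤ (1 + δ) * ((1 + δ)⁻¹) ^ l := by
    intro k l hkl
    rw [hs k]
    exact mul_le_mul_of_nonneg_left (pow_le_pow_of_le_one h0.le h1.le hkl) (by positivity)
  refine ⟨fun n => by positivity, fun n => pow_le_one₀ h0.le h1.le, ?_, fun n => key _ _ (by omega),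
    fun n => key _ _ (by omega)⟩
  have := summable_geometric_of_lt_one h0.le h1
  exact Summable.of_nat_of_neg (by simpa using this) (by simpa using this)

/-- One site's share of the energy derivative, with `r'`, `r`, `rp` the weights at `n - 1`, `n`, `n
+ 1`. The Laplacian contributes a difference of fluxes, which telescopes after summation, and an
error due to the variation of the weight, proportional to `q - 1`. -/
theorem energy_term_le {κ h q K l r r' : ℝ} (hh : 0 < h) (hK : 0 ≤ K) (hl : 0 < l)
    (hr : 0 < r) (hr1 : r ≤ 1) (hq : 1 ≤ q) (h1 : r ≤ q * r') (h2 : r' ≤ q * r)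
    {rp : ℝ} (h3 : r ≤ q * rp) (wm w wp f g : ℂ)
    (hf : ‖f‖ ≤ ‖g‖ + K * (‖wm‖ + ‖w‖ + ‖wp‖)) :
    h * r * (2 * inner ℝ w (Complex.I * (κ * (wp + wm - 2 * w)) + f)) ≤
      -(2 * h * κ * (r * (starRingEnd ℂ w * wp).im)) -
        (-(2 * h * κ * (r' * (starRingEnd ℂ wm * w).im))) +
      |κ| * (q - 1) * (h * r' * ‖wm‖ ^ 2 + h * r * ‖w‖ ^ 2) + l * (h * r * ‖w‖ ^ 2) +
      l⁻¹ * (h * ‖g‖ ^ 2) +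
      K * (4 * (h * r * ‖w‖ ^ 2) + q * (h * rp * ‖wp‖ ^ 2) + q * (h * r' * ‖wm‖ ^ 2)) := by
  have e1 : inner ℝ w (Complex.I * (κ * (wp + wm - 2 * w)) + f) =
      -κ * ((starRingEnd ℂ w * wp).im - (starRingEnd ℂ wm * w).im) + inner ℝ w f := by
    rw [inner_add_right]
    congr 1
    rw [Complex.inner]
    simp; ring
  have e2 : (2 : ℝ) * inner ℝ w f ≤ l * ‖w‖ ^ 2 + l⁻¹ * ‖g‖ ^ 2 +
      K * (4 * ‖w‖ ^ 2 + ‖wp‖ ^ 2 + ‖wm‖ ^ 2) := by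
    have i1 : inner ℝ w f ≤ ‖w‖ * ‖f‖ := real_inner_le_norm w f
    have i2 := mul_le_mul_of_nonneg_left hf (norm_nonneg w)
    have i3 : 2 * (‖w‖ * ‖g‖) ≤ l * ‖w‖ ^ 2 + l⁻¹ * ‖g‖ ^ 2 := by
      have : 0 ≤ l⁻¹ * (l * ‖w‖ - ‖g‖) ^ 2 := by positivity
      have e : l⁻¹ * (l * ‖w‖ - ‖g‖) ^ 2 = l * ‖w‖ ^ 2 + l⁻¹ * ‖g‖ ^ 2 - 2 * (‖w‖ * ‖g‖) := by
        field_simp; ring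
      linarith
    nlinarith [mul_nonneg hK (sq_nonneg (‖w‖ - ‖wp‖)), mul_nonneg hK (sq_nonneg (‖w‖ - ‖wm‖))]
  have e3 : 2 * κ * ((r - r') * (starRingEnd ℂ wm * w).im) ≤
      |κ| * (q - 1) * (r' * ‖wm‖ ^ 2 + r * ‖w‖ ^ 2) := by
    have i1 : |r - r'| ≤ (q - 1) * r' := by
      rw [abs_le]; constructor <;> nlinarith
    have i2 : |r - r'| ≤ (q - 1) * r := by
      rw [abs_le]; constructor <;> nlinarith
    have i3 : |(starRingEnd ℂ wm * w).im| ≤ ‖wm‖ * ‖w‖ := by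
      refine (Complex.abs_im_le_norm _).trans ?_
      simp
    have i4 : 2 * |(starRingEnd ℂ wm * w).im| ≤ ‖wm‖ ^ 2 + ‖w‖ ^ 2 := by
      nlinarith [sq_nonneg (‖wm‖ - ‖w‖)]
    calc 2 * κ * ((r - r') * (starRingEnd ℂ wm * w).im)
        ≤ |2 * κ * ((r - r') * (starRingEnd ℂ wm * w).im)| := le_abs_self _
      _ = |κ| * (|r - r'| * (2 * |(starRingEnd ℂ wm * w).im|)) := by
          rw [abs_mul, abs_mul, abs_mul]; simp; ring
      _ ≤ |κ| * (|r - r'| * (‖wm‖ ^ 2 + ‖w‖ ^ 2)) := by gcongr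
      _ = |κ| * (|r - r'| * ‖wm‖ ^ 2 + |r - r'| * ‖w‖ ^ 2) := by ring
      _ ≤ |κ| * ((q - 1) * r' * ‖wm‖ ^ 2 + (q - 1) * r * ‖w‖ ^ 2) := by gcongr
      _ = _ := by ring
  have i5 : h * r * (l⁻¹ * ‖g‖ ^ 2) ≤ l⁻¹ * (h * ‖g‖ ^ 2) := by
    calc _ = r * (l⁻¹ * (h * ‖g‖ ^ 2)) := by ring
      _ ≤ 1 * (l⁻¹ * (h * ‖g‖ ^ 2)) := by gcongr
      _ = _ := one_mul _
  have i6 : h * r * (K * (4 * ‖w‖ ^ 2 + ‖wp‖ ^ 2 + ‖wm‖ ^ 2)) ≤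
      K * (4 * (h * r * ‖w‖ ^ 2) + q * (h * rp * ‖wp‖ ^ 2) + q * (h * r' * ‖wm‖ ^ 2)) := by
    calc _ = K * (4 * (h * r * ‖w‖ ^ 2) + h * r * ‖wp‖ ^ 2 + h * r * ‖wm‖ ^ 2) := by ring
      _ ≤ K * (4 * (h * r * ‖w‖ ^ 2) + h * (q * rp) * ‖wp‖ ^ 2 + h * (q * r') * ‖wm‖ ^ 2) := by
          gcongr
      _ = _ := by ring
  have i7 := mul_le_mul_of_nonneg_left e2 (show 0 ≤ h * r by positivity)
  have i8 := mul_le_mul_of_nonneg_left e3 hh.le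
  rw [e1]
  linarith

/-- Derivative estimate for a weighted energy of a lattice flow. -/
theorem energy_deriv_le {κ h q K l G : ℝ} {ρ : ℤ → ℝ} (hh : 0 < h) (hK : 0 ≤ K) (hl : 0 < l)
    (hq : 1 ≤ q) (hρ : IsSlowWeight q ρ) {w f g : ℤ → ℂ} {M : ℝ} (hM : ∀ n, ‖w n‖ ≤ M)
    (hf : ∀ n, ‖f n‖ ≤ ‖g n‖ + K * (‖w (n - 1)‖ + ‖w n‖ + ‖w (n + 1)‖))
    (hg : LatticeL2Le h g G)
    (hs : Summable fun n =>
      h * ρ n * (2 * inner ℝ (w n) (Complex.I * (κ * discreteLaplacian w n) + f n))) :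
    ∑' n, h * ρ n * (2 * inner ℝ (w n) (Complex.I * (κ * discreteLaplacian w n) + f n)) ≤
      (2 * |κ| * (q - 1) + 6 * K * q + l) * ∑' n, h * ρ n * ‖w n‖ ^ 2 + l⁻¹ * G ^ 2 := by
  have hM0 : 0 ≤ M := (norm_nonneg _).trans (hM 0)
  have se : Summable fun n => h * ρ n * ‖w n‖ ^ 2 := by
    refine Summable.of_nonneg_of_le (fun n => by have := hρ.pos n; positivity) (fun n => ?_)
      (hρ.summable.mul_left (h * M ^ 2))
    have := hρ.pos n
    calc h * ρ n * ‖w n‖ ^ 2 ≤ h * ρ n * M ^ 2 := by gcongr; exact hM n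
      _ = _ := by ring
  have sX : Summable fun n =>
      -(2 * h * κ * (ρ n * (starRingEnd ℂ (w n) * w (n + 1)).im)) := by
    refine Summable.of_norm_bounded (hρ.summable.mul_left (2 * h * |κ| * (M * M))) (fun n => ?_)
    have := hρ.pos n
    rw [norm_neg, Real.norm_eq_abs, abs_mul, abs_mul, abs_mul, abs_mul, abs_of_pos hh,
      abs_of_pos this, abs_of_pos (two_pos : (0:ℝ) < 2)]
    have i3 : |(starRingEnd ℂ (w n) * w (n + 1)).im| ≤ M * M := by
      refine (Complex.abs_im_le_norm _).trans ?_
      rw [norm_mul, RCLike.norm_conj]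
      exact mul_le_mul (hM _) (hM _) (norm_nonneg _) hM0
    calc _ ≤ 2 * h * |κ| * (ρ n * (M * M)) := by gcongr
      _ = _ := by ring
  have sg : Summable fun n => h * ‖g n‖ ^ 2 :=
    summable_of_sum_le (c := G ^ 2) (fun n => by positivity) fun s => by
      rw [← Finset.mul_sum]; exact hg.sum_le s
  have tg : ∑' n, h * ‖g n‖ ^ 2 ≤ G ^ 2 :=
    Real.tsum_le_of_sum_le (fun n => by positivity) fun s => by
      rw [← Finset.mul_sum]; exact hg.sum_le s
  have he := se.hasSum
  have hem := (Equiv.subRight (1 : ℤ)).hasSum_iff.2 he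
  have hep := (Equiv.addRight (1 : ℤ)).hasSum_iff.2 he
  have hX := sX.hasSum
  have hXm := (Equiv.subRight (1 : ℤ)).hasSum_iff.2 hX
  simp only [Function.comp_def, Equiv.subRight_apply, Equiv.coe_addRight, sub_add_cancel]
    at hem hep hXm
  have tot := ((((hX.sub hXm).add ((hem.add he).mul_left (|κ| * (q - 1)))).add
    (he.mul_left l)).add (sg.hasSum.mul_left l⁻¹)).add
    ((((he.mul_left 4).add (hep.mul_left q)).add (hem.mul_left q)).mul_left K)
  have key := hasSum_le (fun n => ?_) hs.hasSum tot
  · set E := ∑' n, h * ρ n * ‖w n‖ ^ 2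
    have hE : 0 ≤ E := tsum_nonneg fun n => by have := hρ.pos n; positivity
    have j1 : l⁻¹ * ∑' n, h * ‖g n‖ ^ 2 ≤ l⁻¹ * G ^ 2 := by gcongr
    have j2 : 0 ≤ K * E * (q - 1) := mul_nonneg (mul_nonneg hK hE) (by linarith)
    refine key.trans ?_
    linarith
  · have a1 := hρ.succ_le (n - 1)
    have a2 := hρ.le_succ (n - 1)
    rw [sub_add_cancel] at a1 a2
    exact energy_term_le hh hK hl (hρ.pos n) (hρ.le_one n) hq a1 a2
      (hρ.le_succ n) (w (n - 1)) (w n) (w (n + 1)) (f n) (g n) (hf n)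

theorem norm_discreteLaplacian_le {a : ℤ → ℂ} {M : ℝ} (ha : ∀ n, ‖a n‖ ≤ M) (n : ℤ) :
    ‖discreteLaplacian a n‖ ≤ 4 * M := by
  unfold discreteLaplacian
  have h1 := norm_sub_le (a (n + 1) + a (n - 1)) (2 * a n)
  have h2 := norm_add_le (a (n + 1)) (a (n - 1))
  rw [norm_mul, Complex.norm_ofNat] at h1
  linarith [ha n, ha (n + 1), ha (n - 1)]

theorem LatticeL2Le.norm_le_of_one_term {h A : ℝ} {a : ℤ → ℂ} (hh : 0 < h)
    (ha : LatticeL2Le h a A) (n : ℤ) : ‖a n‖ ≤ √(A ^ 2 / h) := by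
  have := ha.sum_le {n}
  rw [Finset.sum_singleton] at this
  refine Real.le_sqrt_of_sq_le ?_
  rw [le_div_iff₀ hh]; linarith

/-- The `L²` estimate for a lattice flow whose forcing is, up to an `L²` function, controlled
pointwise by the neighbouring values of the solution. -/
theorem LatticeFlow.l2_le {κ h K W G t₀ t₁ : ℝ} {w f g : ℝ → ℤ → ℂ} (hh : 0 < h) (hK : 0 ≤ K)
    (hw : LatticeFlow κ f t₀ t₁ w)
    (hf : ∀ t ∈ Ioo t₀ t₁, ∀ n,
      ‖f t n‖ ≤ ‖g t n‖ + K * (‖w t (n - 1)‖ + ‖w t n‖ + ‖w t (n + 1)‖))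
    (hG : 0 ≤ G) (hg : ∀ t ∈ Ioo t₀ t₁, LatticeL2Le h (g t) G) (h0 : LatticeL2Le h (w t₀) W)
    {t : ℝ} (ht : t ∈ Icc t₀ t₁) :
    LatticeL2Le h (w t) (Real.exp (3 * K * (t - t₀)) * (W + (t - t₀) * G)) := by
  have htt : 0 ≤ t - t₀ := sub_nonneg.2 ht.1
  obtain ⟨M, hM⟩ := hw.bdd
  have hM0 : 0 ≤ M := (norm_nonneg _).trans (hM t ht 0)
  refine ⟨by have := h0.nonneg; positivity, fun s => ?_⟩
  have fin : ∀ δ : ℝ, 0 < δ → h * ∑ n ∈ s, ((1 + δ)⁻¹) ^ n.natAbs * ‖w t n‖ ^ 2 ≤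
      (Real.exp ((2 * |κ| * (1 + δ - 1) + 6 * K * (1 + δ)) / 2 * (t - t₀)) *
        (√(W ^ 2 + δ ^ 2) + (t - t₀) * (G + δ))) ^ 2 := by
    intro δ hδ
    have hρ := isSlowWeight_pow hδ
    set ρ : ℤ → ℝ := fun n : ℤ => ((1 + δ)⁻¹) ^ n.natAbs with hρdef
    set E : ℝ → ℝ := fun t => if t ∈ Icc t₀ t₁ then ∑' n, h * ρ n * ‖w t n‖ ^ 2 else 0 with hEdef
    have hsum : ∀ t ∈ Icc t₀ t₁, Summable fun n => h * ρ n * ‖w t n‖ ^ 2 := by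
      intro t ht
      refine Summable.of_nonneg_of_le (fun n => by have := hρ.pos n; positivity) (fun n => ?_)
        (hρ.summable.mul_left (h * M ^ 2))
      have := hρ.pos n
      calc h * ρ n * ‖w t n‖ ^ 2 ≤ h * ρ n * M ^ 2 := by gcongr; exact hM t ht n
        _ = _ := by ring
    have hEval : ∀ t ∈ Icc t₀ t₁, E t = ∑' n, h * ρ n * ‖w t n‖ ^ 2 := fun t ht => if_pos ht
    have hE0 : ∀ t, 0 ≤ E t := by
      intro t
      simp only [hEdef]
      split_ifs
      · exact tsum_nonneg fun n => by have := hρ.pos n; positivity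
      · exact le_rfl
    have hEc : ContinuousOn E (Icc t₀ t₁) := by
      refine ContinuousOn.congr ?_ hEval
      refine continuousOn_tsum (u := fun n => h * M ^ 2 * ρ n) (fun n => ?_)
        (hρ.summable.mul_left _) fun n t ht => ?_
      · exact continuousOn_const.mul ((hw.cont n).norm.pow 2)
      · have := hρ.pos n
        rw [Real.norm_of_nonneg (by positivity)]
        calc h * ρ n * ‖w t n‖ ^ 2 ≤ h * ρ n * M ^ 2 := by gcongr; exact hM t ht n
          _ = _ := by ring
    set D : ℝ → ℤ → ℝ := fun t n => h * ρ n *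
      (2 * inner ℝ (w t n) (Complex.I * (κ * discreteLaplacian (w t) n) + f t n)) with hDdef
    -- At fixed `h`, an `L²` bound on `g` bounds each of its values, so the derivatives of the terms
    -- have a summable majorant and the series can be differentiated termwise.
    set L := 2 * (M * (|κ| * (4 * M) + (√(G ^ 2 / h) + K * (M + M + M)))) with hL
    have hDb : ∀ n, ∀ t ∈ Ioo t₀ t₁, ‖D t n‖ ≤ h * L * ρ n := by
      intro n t ht
      have ht' := Ioo_subset_Icc_self ht
      have := hρ.pos n
      have i1 := norm_inner_le_norm (𝕜 := ℝ) (w t n)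
        (Complex.I * (κ * discreteLaplacian (w t) n) + f t n)
      have i2 : ‖Complex.I * (κ * discreteLaplacian (w t) n) + f t n‖ ≤
          |κ| * (4 * M) + (√(G ^ 2 / h) + K * (M + M + M)) := by
        refine (norm_add_le _ _).trans (add_le_add ?_ ((hf t ht n).trans ?_))
        · rw [norm_mul, norm_mul, Complex.norm_I, one_mul, Complex.norm_real, Real.norm_eq_abs]
          gcongr; exact norm_discreteLaplacian_le (hM t ht') n
        · have := (hg t ht).norm_le_of_one_term hh n
          gcongr
          all_goals exact hM t ht' _
      have i3 := i1.trans (mul_le_mul (hM t ht' n) i2 (norm_nonneg _) hM0)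
      rw [hDdef, norm_mul, norm_mul, norm_mul, Real.norm_of_nonneg hh.le,
        Real.norm_of_nonneg this.le, Real.norm_of_nonneg (by norm_num : (0:ℝ) ≤ 2), hL]
      calc _ ≤ h * ρ n * (2 * (M * (|κ| * (4 * M) + (√(G ^ 2 / h) + K * (M + M + M))))) := by
            gcongr
        _ = _ := by ring
    have hEd : ∀ t ∈ Ioo t₀ t₁, HasDerivAt E (∑' n, D t n) t := by
      intro t ht
      have h1 := hasDerivAt_tsum_of_isPreconnected (u := fun n => h * L * ρ n)
        (g := fun n t => h * ρ n * ‖w t n‖ ^ 2) (g' := fun n t => D t n)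
        (hρ.summable.mul_left _) isOpen_Ioo isPreconnected_Ioo
        (fun n t ht => ((hw.deriv n t ht).norm_sq).const_mul _) hDb ht
        (hsum t (Ioo_subset_Icc_self ht)) ht
      refine h1.congr_of_eventuallyEq ?_
      filter_upwards [Ioo_mem_nhds ht.1 ht.2] with y hy using hEval y (Ioo_subset_Icc_self hy)
    -- `G + δ` replaces `G` because `sqrt_gronwall` requires a positive forcing bound.
    have hb : ∀ t ∈ Ioo t₀ t₁, ∀ l : ℝ, 0 < l → ∑' n, D t n ≤
        (2 * |κ| * (1 + δ - 1) + 6 * K * (1 + δ) + l) * E t + l⁻¹ * (G + δ) ^ 2 := by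
      intro t ht l hl
      rw [hEval t (Ioo_subset_Icc_self ht)]
      exact energy_deriv_le hh hK hl (by linarith) hρ (hM t (Ioo_subset_Icc_self ht)) (hf t ht)
        ((hg t ht).mono (by linarith))
        (Summable.of_norm_bounded (hρ.summable.mul_left (h * L)) fun n => hDb n t ht)
    have fin := sqrt_gronwall (a := 2 * |κ| * (1 + δ - 1) + 6 * K * (1 + δ)) (G := G + δ)
      (by rw [add_sub_cancel_left]; positivity) (by linarith) hδ hEc hE0 hEd hb ht
    have hEt0 : E t₀ ≤ W ^ 2 := by
      have m0 : t₀ ∈ Icc t₀ t₁ := left_mem_Icc.2 (ht.1.trans ht.2)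
      rw [hEval t₀ m0]
      refine Real.tsum_le_of_sum_le (fun n => by have := hρ.pos n; positivity) fun s => ?_
      refine le_trans ?_ (h0.sum_le s)
      rw [Finset.mul_sum]
      refine Finset.sum_le_sum fun n _ => ?_
      have := hρ.le_one n
      calc h * ρ n * ‖w t₀ n‖ ^ 2 ≤ h * 1 * ‖w t₀ n‖ ^ 2 := by gcongr
        _ = _ := by ring
    have hfin : h * ∑ n ∈ s, ρ n * ‖w t n‖ ^ 2 ≤ E t := by
      rw [hEval t ht, Finset.mul_sum]
      simp only [← mul_assoc]
      exact (hsum t ht).sum_le_tsum s fun n _ => by have := hρ.pos n; positivity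
    calc h * ∑ n ∈ s, ρ n * ‖w t n‖ ^ 2 ≤ E t + δ ^ 2 := by nlinarith
      _ = √(E t + δ ^ 2) ^ 2 := (Real.sq_sqrt (by have := hE0 t; positivity)).symm
      _ ≤ _ := by
        refine pow_le_pow_left₀ (Real.sqrt_nonneg _) (fin.trans ?_) 2
        gcongr
  -- On a fixed finite set of sites the weight tends to 1 as `δ → 0`, and the contribution of `κ` to
  -- the exponent disappears. The bound is therefore uniform in `κ = h⁻²`.
  have T1 : Tendsto (fun δ : ℝ => h * ∑ n ∈ s, ((1 + δ)⁻¹) ^ n.natAbs * ‖w t n‖ ^ 2) (𝓝[>] 0)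
      (𝓝 (h * ∑ n ∈ s, ‖w t n‖ ^ 2)) := by
    have : ContinuousAt (fun δ : ℝ => h * ∑ n ∈ s, ((1 + δ)⁻¹) ^ n.natAbs * ‖w t n‖ ^ 2) 0 := by
      refine continuousAt_const.mul (tendsto_finsetSum _ fun n _ => ?_)
      refine ContinuousAt.mul (ContinuousAt.pow (ContinuousAt.inv₀ (by fun_prop) (by simp)) _)
        continuousAt_const
    have h2 := this.tendsto
    simp only [add_zero, inv_one, one_pow, one_mul] at h2
    exact h2.mono_left nhdsWithin_le_nhds
  have T2 : Tendsto (fun δ : ℝ =>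
      (Real.exp ((2 * |κ| * (1 + δ - 1) + 6 * K * (1 + δ)) / 2 * (t - t₀)) *
        (√(W ^ 2 + δ ^ 2) + (t - t₀) * (G + δ))) ^ 2) (𝓝[>] 0)
      (𝓝 ((Real.exp (3 * K * (t - t₀)) * (W + (t - t₀) * G)) ^ 2)) := by
    have : Continuous (fun δ : ℝ =>
      (Real.exp ((2 * |κ| * (1 + δ - 1) + 6 * K * (1 + δ)) / 2 * (t - t₀)) *
        (√(W ^ 2 + δ ^ 2) + (t - t₀) * (G + δ))) ^ 2) := by fun_prop
    have h2 := this.tendsto 0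
    have e : (2 * |κ| * (1 + (0:ℝ) - 1) + 6 * K * (1 + 0)) / 2 * (t - t₀) = 3 * K * (t - t₀) := by
      ring
    have e2 : √(W ^ 2 + (0:ℝ) ^ 2) = W := by simp [Real.sqrt_sq h0.nonneg]
    rw [e, e2, add_zero] at h2
    exact h2.mono_left nhdsWithin_le_nhds
  refine le_of_tendsto_of_tendsto T1 T2 ?_
  filter_upwards [self_mem_nhdsWithin] with δ hδ using fin δ hδ

/-! ### Difference quotients of sampled functions. -/

theorem sq_integral_le_mul_integral_sq {g : ℝ → ℝ} (hg : Continuous g) {a b : ℝ} (hab : a < b) :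
    (∫ y in a..b, g y) ^ 2 ≤ (b - a) * ∫ y in a..b, g y ^ 2 := by
  have hba : 0 < b - a := sub_pos.2 hab
  set I := ∫ y in a..b, g y with hI
  set c := I / (b - a) with hc
  have h0 : 0 ≤ ∫ y in a..b, (g y - c) ^ 2 :=
    intervalIntegral.integral_nonneg hab.le fun y _ => sq_nonneg _
  have e : ∫ y in a..b, (g y - c) ^ 2 =
      (∫ y in a..b, g y ^ 2) - 2 * c * I + c ^ 2 * (b - a) := by
    have : ∀ y, (g y - c) ^ 2 = g y ^ 2 - 2 * c * g y + c ^ 2 := fun y => by ring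
    simp only [this]
    rw [intervalIntegral.integral_add, intervalIntegral.integral_sub,
      intervalIntegral.integral_const_mul, intervalIntegral.integral_const, smul_eq_mul]
    · ring
    all_goals exact Continuous.intervalIntegrable (by fun_prop) _ _
  rw [e] at h0
  have hcI : c * (b - a) = I := by rw [hc]; field_simp
  have := mul_nonneg h0 hba.le
  nlinarith

theorem hasDerivAt_fwdDiff_iter {h : ℝ} (k : ℕ) {f : ℝ → ℂ} (hf : Differentiable ℝ f) (x : ℝ) :
    HasDerivAt ((fwdDiff h)^[k] f) ((fwdDiff h)^[k] (deriv f) x) x := by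
  induction k generalizing x with
  | zero => exact (hf x).hasDerivAt
  | succ k ih =>
    simp only [Function.iterate_succ_apply']
    exact ((ih (x + h)).comp_add_const x h).sub (ih x)

/-- Induction through the mean value inequality: an iterated difference of `f` has as derivative the
same difference of `f'`, bounded on all of `[x, x + h)` by one integral over a slightly longer
interval. -/
theorem norm_fwdDiff_iter_le {h : ℝ} (hh : 0 < h) (k : ℕ) {f : ℝ → ℂ}
    (hf : ContDiff ℝ (k + 1 : ℕ) f) (x : ℝ) :
    ‖(fwdDiff h)^[k + 1] f x‖ ≤
      h ^ k * ∫ y in x..(x + (k + 1 : ℕ) * h), ‖iteratedDeriv (k + 1) f y‖ := by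
  induction k generalizing f x with
  | zero =>
    have hd : Differentiable ℝ f := hf.differentiable (by simp)
    have hc : Continuous (deriv f) := hf.continuous_deriv (by simp)
    have := intervalIntegral.integral_deriv_eq_sub (a := x) (b := x + h) (f := f)
      (fun y _ => hd y) (hc.intervalIntegrable _ _)
    simp only [zero_add, Function.iterate_one, fwdDiff, pow_zero, one_mul, Nat.cast_one,
      iteratedDeriv_one]
    rw [← this]
    exact intervalIntegral.norm_integral_le_integral_norm (by linarith)
  | succ k ih =>
    have hd : Differentiable ℝ f := hf.differentiable (by simp)
    have hd' : ContDiff ℝ (k + 1 : ℕ) (deriv f) := by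
      have : ContDiff ℝ ((k + 1 : ℕ) + 1) f := by exact_mod_cast hf
      exact (contDiff_succ_iff_deriv.1 this).2.2
    have hcn : Continuous fun y => ‖iteratedDeriv (k + 1 + 1) f y‖ :=
      (hf.continuous_iteratedDeriv (k + 1 + 1) le_rfl).norm
    rw [Function.iterate_succ_apply']
    have hb : ∀ y ∈ Ico x (x + h), ‖(fwdDiff h)^[k + 1] (deriv f) y‖ ≤
        h ^ k * ∫ y in x..(x + (k + 1 + 1 : ℕ) * h), ‖iteratedDeriv (k + 1 + 1) f y‖ := by
      intro y hy
      refine (ih hd' y).trans ?_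
      rw [← iteratedDeriv_succ']
      have hk : 0 ≤ ((k + 1 : ℕ) : ℝ) * h := by positivity
      gcongr
      refine intervalIntegral.integral_mono_interval hy.1 (by linarith) ?_
        (Eventually.of_forall fun _ => norm_nonneg _) (hcn.intervalIntegrable _ _)
      push_cast
      linarith [hy.2]
    have := norm_image_sub_le_of_norm_deriv_le_segment' (a := x) (b := x + h)
      (fun y _ => (hasDerivAt_fwdDiff_iter (h := h) (k + 1) hd y).hasDerivWithinAt) hb (x + h)
      (right_mem_Icc.2 (by linarith))
    rw [fwdDiff]
    refine this.trans (le_of_eq ?_)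
    ring

theorem sum_integral_translates_le {g : ℝ → ℝ} (hg : MeasureTheory.Integrable g)
    (hg0 : ∀ y, 0 ≤ g y) {h : ℝ} (x₀ : ℝ) (s : Finset ℤ) (hh : 0 < h) :
    ∑ n ∈ s, ∫ y in (x₀ + n * h)..(x₀ + (n + 1) * h), g y ≤ ∫ y, g y := by
  have e : ∀ n : ℤ, ∫ y in (x₀ + n * h)..(x₀ + (n + 1) * h), g y =
      ∫ y in Ioc (x₀ + n • h) (x₀ + (n + 1) • h), g y := by
    intro n
    rw [intervalIntegral.integral_of_le (by nlinarith)]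
    simp
  simp only [e]
  rw [← MeasureTheory.integral_biUnion_finset s (fun _ _ => measurableSet_Ioc)
    (fun i _ j _ hij => pairwise_disjoint_Ioc_add_zsmul x₀ h hij) (fun _ _ => hg.integrableOn)]
  exact MeasureTheory.setIntegral_le_integral hg (Eventually.of_forall hg0)

theorem latticeDiff_iter_sample {h : ℝ} {f : ℝ → ℂ} {x : ℤ → ℝ} (hx : ∀ n, x (n + 1) = x n + h)
    (k : ℕ) (n : ℤ) :
    (latticeDiff h)^[k] (fun n => f (x n)) n = (fwdDiff h)^[k] f (x n) / (h : ℂ) ^ k := by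
  induction k generalizing n with
  | zero => simp
  | succ k ih =>
    rw [Function.iterate_succ_apply', Function.iterate_succ_apply', latticeDiff, ih, ih, hx,
      fwdDiff, ← sub_div, div_div, pow_succ]

/-- The discrete `L²` norms of the difference quotients of a sampled function are controlled by
the `L²` norms of its derivatives, uniformly in the mesh size. -/
theorem latticeL2Le_sample {h : ℝ} (hh : 0 < h) {f : ℝ → ℂ} {x : ℤ → ℝ}
    (hx : ∀ n, x (n + 1) = x n + h) (k : ℕ) (hf : ContDiff ℝ (k + 1 : ℕ) f)
    (hL2 : MeasureTheory.MemLp (iteratedDeriv (k + 1) f) 2) :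
    LatticeL2Le h ((latticeDiff h)^[k + 1] (fun n => f (x n)))
      ((k + 1) * √(∫ y, ‖iteratedDeriv (k + 1) f y‖ ^ 2)) := by
  refine ⟨by positivity, fun s => ?_⟩
  set g : ℝ → ℝ := fun y => ‖iteratedDeriv (k + 1) f y‖ with hg
  have hgc : Continuous g := (hf.continuous_iteratedDeriv (k + 1) le_rfl).norm
  have hgi : MeasureTheory.Integrable fun y => g y ^ 2 := hL2.norm.integrable_sq
  have hI : 0 ≤ ∫ y, g y ^ 2 := MeasureTheory.integral_nonneg fun y => sq_nonneg _
  have hxn : ∀ n : ℤ, x n = x 0 + n * h := by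
    intro n
    induction n using Int.induction_on with
    | zero => simp
    | succ i ih => rw [hx, ih]; push_cast; ring
    | pred i ih =>
      have := hx (-(i : ℤ) - 1)
      rw [sub_add_cancel, ih] at this
      push_cast at this ⊢; linarith
  -- Cauchy–Schwarz on an interval of length `(k + 1) h` gives one factor `k + 1`. That interval
  -- consists of `k + 1` cells, so summing over `n` covers the line at most `k + 1` times and gives
  -- the other.
  have term : ∀ n, h * ‖(latticeDiff h)^[k + 1] (fun n => f (x n)) n‖ ^ 2 ≤
      (k + 1) * ∑ j ∈ Finset.range (k + 1),
        ∫ y in ((x 0 + j * h) + n * h)..((x 0 + j * h) + (n + 1) * h), g y ^ 2 := by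
    intro n
    have b1 := norm_fwdDiff_iter_le hh k hf (x n)
    have b2 := sq_integral_le_mul_integral_sq hgc (a := x n) (b := x n + (k + 1 : ℕ) * h)
      (by have : 0 < ((k + 1 : ℕ) : ℝ) * h := by positivity
          linarith)
    have e : ∫ y in (x n)..(x n + (k + 1 : ℕ) * h), g y ^ 2 = ∑ j ∈ Finset.range (k + 1),
        ∫ y in ((x 0 + j * h) + n * h)..((x 0 + j * h) + (n + 1) * h), g y ^ 2 := by
      have := intervalIntegral.sum_integral_adjacent_intervals (f := fun y => g y ^ 2)
        (μ := MeasureTheory.volume) (a := fun j : ℕ => x n + j * h) (n := k + 1)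
        (fun j _ => (hgc.pow 2).intervalIntegrable _ _)
      simp only [Nat.cast_zero, zero_mul, add_zero] at this
      rw [← this]
      refine Finset.sum_congr rfl fun j _ => ?_
      congr 1
      · rw [hxn n]; ring
      · rw [hxn n]; push_cast; ring
    rw [latticeDiff_iter_sample hx, norm_div, norm_pow, Complex.norm_real,
      Real.norm_of_nonneg hh.le, ← e, div_pow, ← mul_div_assoc, div_le_iff₀ (by positivity)]
    calc h * ‖(fwdDiff h)^[k + 1] f (x n)‖ ^ 2
        ≤ h * (h ^ k * ∫ y in (x n)..(x n + (k + 1 : ℕ) * h), g y) ^ 2 := by gcongr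
      _ = h * (h ^ k) ^ 2 * (∫ y in (x n)..(x n + (k + 1 : ℕ) * h), g y) ^ 2 := by ring
      _ ≤ h * (h ^ k) ^ 2 * ((x n + (k + 1 : ℕ) * h - x n) *
            ∫ y in (x n)..(x n + (k + 1 : ℕ) * h), g y ^ 2) := by gcongr
      _ = _ := by push_cast; ring
  rw [Finset.mul_sum]
  calc _ ≤ ∑ n ∈ s, (k + 1) * ∑ j ∈ Finset.range (k + 1),
        ∫ y in ((x 0 + j * h) + n * h)..((x 0 + j * h) + (n + 1) * h), g y ^ 2 :=
        Finset.sum_le_sum fun n _ => term n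
    _ = (k + 1) * ∑ j ∈ Finset.range (k + 1), ∑ n ∈ s,
        ∫ y in ((x 0 + j * h) + n * h)..((x 0 + j * h) + (n + 1) * h), g y ^ 2 := by
        rw [← Finset.mul_sum, Finset.sum_comm]
    _ ≤ (k + 1) * ∑ j ∈ Finset.range (k + 1), ∫ y, g y ^ 2 := by
        gcongr with j _
        exact sum_integral_translates_le hgi (fun y => sq_nonneg _) _ s hh
    _ = ((k + 1) * √(∫ y, g y ^ 2)) ^ 2 := by
        rw [mul_pow, Real.sq_sqrt hI]
        simp; ring

/-- Samples of a bounded `C³` function with derivatives in `L²` are bounded in the discrete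
Zhidkov space uniformly in the lattice. -/
theorem exists_zhidkovLe_sample {u₀ : ℝ → ℂ} (hu₀ : ContDiff ℝ 3 u₀)
    (hbdd : ∃ B : ℝ, ∀ x : ℝ, ‖u₀ x‖ ≤ B)
    (hL2 : ∀ k : ℕ, 1 ≤ k → k ≤ 3 →
      MeasureTheory.MemLp (iteratedDeriv k u₀) 2 MeasureTheory.volume) :
    ∃ R : ℝ, 0 < R ∧ ∀ h : ℝ, 0 < h → ∀ x : ℤ → ℝ, (∀ n, x n = x (n - 1) + h) →
      ZhidkovLe h (fun n => u₀ (x n)) R := by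
  obtain ⟨B, hB⟩ := hbdd
  have hB0 : 0 ≤ B := (norm_nonneg _).trans (hB 0)
  set N : ℕ → ℝ := fun k => ((k : ℝ) + 1) * √(∫ y, ‖iteratedDeriv (k + 1) u₀ y‖ ^ 2) with hN
  have hN0 : ∀ k, 0 ≤ N k := fun k => by positivity
  refine ⟨B + N 0 + N 1 + N 2 + 1, by linarith [hN0 0, hN0 1, hN0 2], fun h hh x hx => ?_⟩
  have hx' : ∀ n, x (n + 1) = x n + h := fun n => by rw [hx (n + 1), add_sub_cancel_right]
  have key : ∀ k : ℕ, k ≤ 2 →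
      LatticeL2Le h ((latticeDiff h)^[k + 1] (fun n => u₀ (x n))) (N k) := fun k hk =>
    latticeL2Le_sample hh hx' k (hu₀.of_le (by exact_mod_cast (by omega : k + 1 ≤ 3)))
      (hL2 (k + 1) (by omega) (by omega))
  have h0 := hN0 0
  have h1 := hN0 1
  have h2 := hN0 2
  exact ⟨fun n => (hB _).trans (by linarith), (key 0 (by norm_num)).mono (by linarith),
    (key 1 (by norm_num)).mono (by linarith), (key 2 (by norm_num)).mono (by linarith)⟩

/-! ### Growth of Zhidkov and Sobolev norms along a flow. -/

theorem discreteLaplacian_eq {h : ℝ} (hh : h ≠ 0) (a : ℤ → ℂ) (n : ℤ) :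
    discreteLaplacian a n = (h : ℂ) ^ 2 * latticeDiff h (latticeDiff h a) (n + -1) := by
  have : (h : ℂ) ≠ 0 := by exact_mod_cast hh
  have e1 : n + -1 + 1 + 1 = n + 1 := by ring
  have e2 : n + -1 + 1 = n := by ring
  rw [discreteLaplacian, latticeDiff, latticeDiff, latticeDiff, e1, e2, ← sub_eq_add_neg]
  field_simp
  ring

namespace LatticeFlow

variable {κ h t₀ t₁ : ℝ} {f w : ℝ → ℤ → ℂ}

theorem restrict (hw : LatticeFlow κ f t₀ t₁ w) {s₀ s₁ : ℝ} (h0 : t₀ ≤ s₀) (h1 : s₁ ≤ t₁) :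
    LatticeFlow κ f s₀ s₁ w := by
  refine ⟨fun n => (hw.cont n).mono (Icc_subset_Icc h0 h1),
    fun n t ht => hw.deriv n t (Ioo_subset_Ioo h0 h1 ht), ?_⟩
  obtain ⟨M, hM⟩ := hw.bdd
  exact ⟨M, fun t ht => hM t (Icc_subset_Icc h0 h1 ht)⟩

theorem latticeDiff (hw : LatticeFlow κ f t₀ t₁ w) (h : ℝ) :
    LatticeFlow κ (fun t => latticeDiff h (f t)) t₀ t₁ (fun t => latticeDiff h (w t)) := by
  refine ⟨fun n => ((hw.cont (n + 1)).sub (hw.cont n)).div_const _, fun n t ht => ?_, ?_⟩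
  · refine (((hw.deriv (n + 1) t ht).sub (hw.deriv n t ht)).div_const (h : ℂ)).congr_deriv ?_
    simp only [discreteLaplacian, _root_.latticeDiff, add_sub_cancel_right, sub_add_cancel]
    ring
  · obtain ⟨M, hM⟩ := hw.bdd
    refine ⟨(M + M) / |h|, fun t ht n => ?_⟩
    rw [_root_.latticeDiff, norm_div, Complex.norm_real, Real.norm_eq_abs]
    gcongr
    exact (norm_sub_le _ _).trans (add_le_add (hM t ht _) (hM t ht _))

theorem sub {g v : ℝ → ℤ → ℂ} (hw : LatticeFlow κ f t₀ t₁ w) (hv : LatticeFlow κ g t₀ t₁ v) :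
    LatticeFlow κ (fun t n => f t n - g t n) t₀ t₁ (fun t n => w t n - v t n) := by
  refine ⟨fun n => (hw.cont n).sub (hv.cont n), fun n t ht => ?_, ?_⟩
  · refine ((hw.deriv n t ht).sub (hv.deriv n t ht)).congr_deriv ?_
    simp only [discreteLaplacian]
    ring
  · obtain ⟨M, hM⟩ := hw.bdd
    obtain ⟨M', hM'⟩ := hv.bdd
    exact ⟨M + M', fun t ht n => (norm_sub_le _ _).trans (add_le_add (hM t ht n) (hM' t ht n))⟩

theorem l2_le_of_forcing_le {W G : ℝ} (hh : 0 < h) (hw : LatticeFlow κ f t₀ t₁ w) (hG : 0 ≤ G)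
    (hf : ∀ t ∈ Ioo t₀ t₁, LatticeL2Le h (f t) G) (h0 : LatticeL2Le h (w t₀) W)
    {t : ℝ} (ht : t ∈ Icc t₀ t₁) : LatticeL2Le h (w t) (W + (t - t₀) * G) := by
  simpa using hw.l2_le hh le_rfl (fun t _ n => by simp) hG hf h0 ht

/-- The increment `c` is paired with the solution, which reduces the claim to the real mean value
inequality with differentiability only in the open interval. -/
theorem norm_sub_le_of_norm_le {C : ℝ} (hw : LatticeFlow κ f t₀ t₁ w) (n : ℤ)
    (hC : ∀ t ∈ Ioo t₀ t₁, ‖Complex.I * (κ * discreteLaplacian (w t) n) + f t n‖ ≤ C)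
    {t : ℝ} (ht : t ∈ Icc t₀ t₁) : ‖w t n - w t₀ n‖ ≤ C * (t - t₀) := by
  rcases eq_or_lt_of_le ht.1 with rfl | hlt
  · simp
  have hC0 : 0 ≤ C := by
    have hm : (t₀ + t) / 2 ∈ Ioo t₀ t₁ := ⟨by linarith, by linarith [ht.2]⟩
    exact (norm_nonneg _).trans (hC _ hm)
  set c := w t n - w t₀ n with hc
  have hd : ∀ s ∈ Ioo t₀ t₁, HasDerivAt (fun s => inner ℝ c (w s n))
      (inner ℝ c (Complex.I * (κ * discreteLaplacian (w s) n) + f s n)) s := by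
    intro s hs
    simpa using (hasDerivAt_const s c).inner ℝ (hw.deriv n s hs)
  have h1 := (convex_Icc t₀ t₁).image_sub_le_mul_sub_of_deriv_le
    (f := fun s => inner ℝ c (w s n)) (C := ‖c‖ * C)
    (continuousOn_const.inner (hw.cont n))
    (by rw [interior_Icc]; exact fun s hs => (hd s hs).differentiableAt.differentiableWithinAt)
    (by
      rw [interior_Icc]
      intro s hs
      rw [(hd s hs).deriv]
      exact (real_inner_le_norm _ _).trans (by gcongr; exact hC s hs))
    t₀ (left_mem_Icc.2 (ht.1.trans ht.2)) t ht ht.1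
  rw [← inner_sub_right, ← hc, real_inner_self_eq_norm_sq] at h1
  rcases (norm_nonneg c).eq_or_lt with h2 | h2
  · rw [← h2]; exact mul_nonneg hC0 (by linarith)
  · nlinarith

/-- Growth of the Zhidkov norm along a lattice flow. -/
theorem zhidkovLe {F S S₀ : ℝ} (hh : 0 < h) (hw : LatticeFlow (h ^ 2)⁻¹ f t₀ t₁ w)
    (hF : 0 ≤ F) (hS : 0 ≤ S) (hf : ∀ t ∈ Ioo t₀ t₁, ZhidkovLe h (f t) F)
    (hwS : ∀ t ∈ Ioo t₀ t₁, ZhidkovLe h (w t) S) (h0 : ZhidkovLe h (w t₀) S₀)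
    {t : ℝ} (ht : t ∈ Icc t₀ t₁) : ZhidkovLe h (w t) (S₀ + (t - t₀) * (F + 2 * S)) := by
  have htt : 0 ≤ t - t₀ := sub_nonneg.2 ht.1
  have le1 : S₀ + (t - t₀) * F ≤ S₀ + (t - t₀) * (F + 2 * S) := by gcongr; linarith
  have d1 := hw.latticeDiff h
  have d2 := d1.latticeDiff h
  have d3 := d2.latticeDiff h
  refine ⟨fun n => ?_, ?_, ?_, ?_⟩
  -- The solution itself need not be in `L²`, so its sup norm is obtained by integrating the
  -- equation in time. Since `κ = h⁻²`, the Laplacian term is a second difference quotient, bounded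
  -- by `2 * S` through the Sobolev embedding.
  · have key := hw.norm_sub_le_of_norm_le n (C := F + 2 * S) (fun s hs => ?_) ht
    · have := norm_le_norm_add_norm_sub' (w t n) (w t₀ n)
      have := h0.norm_le n
      linarith
    · rw [discreteLaplacian_eq hh.ne']
      have hhc : (h : ℂ) ≠ 0 := by exact_mod_cast hh.ne'
      have e : Complex.I * (((h ^ 2)⁻¹ : ℝ) * ((h : ℂ) ^ 2 *
          _root_.latticeDiff h (_root_.latticeDiff h (w s)) (n + -1))) =
          Complex.I * _root_.latticeDiff h (_root_.latticeDiff h (w s)) (n + -1) := by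
        push_cast; field_simp
      rw [e]
      refine (norm_add_le _ _).trans ?_
      rw [norm_mul, Complex.norm_I, one_mul]
      linarith [(hf s hs).norm_le n, (hwS s hs).norm_diff2_le hh (n + -1)]
  · exact (d1.l2_le_of_forcing_le hh hF (fun s hs => (hf s hs).diff1) h0.diff1 ht).mono le1
  · exact (d2.l2_le_of_forcing_le hh hF (fun s hs => (hf s hs).diff2) h0.diff2 ht).mono le1
  · exact (d3.l2_le_of_forcing_le hh hF (fun s hs => (hf s hs).diff3) h0.diff3 ht).mono le1

theorem sobolevLe {F W : ℝ} (hh : 0 < h) (hw : LatticeFlow κ f t₀ t₁ w) (hF : 0 ≤ F)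
    (hf : ∀ t ∈ Ioo t₀ t₁, SobolevLe h (f t) F) (h0 : SobolevLe h (w t₀) W)
    {t : ℝ} (ht : t ∈ Icc t₀ t₁) : SobolevLe h (w t) (W + (t - t₀) * F) :=
  ⟨hw.l2_le_of_forcing_le hh hF (fun s hs => (hf s hs).diff0) h0.diff0 ht,
    (hw.latticeDiff h).l2_le_of_forcing_le hh hF (fun s hs => (hf s hs).diff1) h0.diff1 ht⟩

end LatticeFlow

/-! ### The two nonlinearities and the uniform a priori bound. -/

theorem IsBoundedLatticeSolution.latticeFlow {κ τ : ℝ} {N : (ℤ → ℂ) → ℤ → ℂ} {u : ℝ → ℤ → ℂ}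
    (hu : IsBoundedLatticeSolution κ N τ u) :
    LatticeFlow κ (fun t n => Complex.I * N (u t) n) 0 τ u := by
  refine ⟨hu.continuousOn, fun n t ht => ?_, hu.bounded⟩
  obtain ⟨d, hd, he⟩ := hu.equation n t ht
  refine hd.congr_deriv ?_
  linear_combination (-Complex.I) * he + d * Complex.I_sq

/-- The two properties of a cubic lattice nonlinearity used in the a priori estimates. -/
structure IsTameCubic (N : (ℤ → ℂ) → ℤ → ℂ) (c : ℝ) : Prop where
  nonneg : 0 ≤ c
  zhidkovLe : ∀ {h S : ℝ} {a : ℤ → ℂ}, 0 < h → ZhidkovLe h a S → ZhidkovLe h (N a) (c * S ^ 3)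
  norm_diff_le : ∀ {h M : ℝ} {a : ℤ → ℂ}, (∀ n, ‖a n‖ ≤ M) → ∀ n,
    ‖latticeDiff h (N a) n‖ ≤ c * M ^ 2 *
      (‖latticeDiff h a (n - 1)‖ + ‖latticeDiff h a n‖ + ‖latticeDiff h a (n + 1)‖)

/-- Covers both nonlinearities: `v` is `a` for DNLS and the average of the neighbours for
Ablowitz–Ladik. The bound uses only sup norms, so it applies before any Zhidkov bound is known. -/
theorem norm_latticeDiff_mul_conj_mul_le {h M : ℝ} {a v : ℤ → ℂ} (ha : ∀ n, ‖a n‖ ≤ M)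
    (hv : ∀ n, ‖v n‖ ≤ M) (n : ℤ) :
    ‖latticeDiff h (fun n => a n * starRingEnd ℂ (a n) * v n) n‖ ≤
      M ^ 2 * (2 * ‖latticeDiff h a n‖ + ‖latticeDiff h v n‖) := by
  have hM : 0 ≤ M := (norm_nonneg _).trans (ha 0)
  rw [latticeDiff_mul, latticeDiff_mul, latticeDiff_conj]
  simp only
  set d := latticeDiff h a n
  set e := latticeDiff h v n
  have b1 : ‖d * starRingEnd ℂ (a (n + 1)) * v (n + 1)‖ ≤ ‖d‖ * M * M := by
    rw [norm_mul, norm_mul, RCLike.norm_conj]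
    gcongr
    exacts [ha _, hv _]
  have b2 : ‖a n * starRingEnd ℂ d * v (n + 1)‖ ≤ M * ‖d‖ * M := by
    rw [norm_mul, norm_mul, RCLike.norm_conj]
    gcongr
    exacts [ha _, hv _]
  have b3 : ‖a n * starRingEnd ℂ (a n) * e‖ ≤ M * M * ‖e‖ := by
    rw [norm_mul, norm_mul, RCLike.norm_conj]
    gcongr
    exacts [ha _, ha _]
  rw [add_mul]
  refine (norm_add₃_le).trans ?_
  linarith

theorem dnlsNonlinearity_eq (μ : ℝ) (a : ℤ → ℂ) :
    dnlsNonlinearity μ a = fun n => (μ : ℂ) * (a n * starRingEnd ℂ (a n) * a n) := by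
  funext n
  rw [dnlsNonlinearity, ← Complex.mul_conj']
  ring

theorem alNonlinearity_eq (μ : ℝ) (a : ℤ → ℂ) :
    alNonlinearity μ a = fun n => (μ : ℂ) * (a n * starRingEnd ℂ (a n) *
      ((1 / 2 : ℂ) * (a (n + 1) + a (n + -1)))) := by
  funext n
  rw [alNonlinearity, ← Complex.mul_conj', ← sub_eq_add_neg]
  ring

/-- The constant is `196 = 14²`, one factor 14 for each of the two products in the cubic term. -/
theorem isTameCubic_dnls (μ : ℝ) : IsTameCubic (dnlsNonlinearity μ) (196 * |μ|) := by
  refine ⟨by positivity, fun {h S a} hh ha => ?_, fun {h M a} ha n => ?_⟩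
  · rw [dnlsNonlinearity_eq]
    have := ((ha.mul hh ha.conj).mul hh ha).const_mul hh.le (μ : ℂ)
    refine this.mono (le_of_eq ?_)
    rw [Complex.norm_real, Real.norm_eq_abs]; ring
  · rw [dnlsNonlinearity_eq, latticeDiff_const_mul, norm_mul, Complex.norm_real, Real.norm_eq_abs]
    have b := norm_latticeDiff_mul_conj_mul_le (h := h) ha ha n
    calc _ ≤ |μ| * (M ^ 2 * (2 * ‖latticeDiff h a n‖ + ‖latticeDiff h a n‖)) := by gcongr
      _ = 196 * |μ| * M ^ 2 * (3 / 196 * ‖latticeDiff h a n‖) := by ring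
      _ ≤ _ := by
        gcongr
        linarith [norm_nonneg (latticeDiff h a n), norm_nonneg (latticeDiff h a (n - 1)),
          norm_nonneg (latticeDiff h a (n + 1))]

theorem isTameCubic_al (μ : ℝ) : IsTameCubic (alNonlinearity μ) (196 * |μ|) := by
  refine ⟨by positivity, fun {h S a} hh ha => ?_, fun {h M a} ha n => ?_⟩
  · rw [alNonlinearity_eq]
    have hv := (((ha.shift 1).add hh.le (ha.shift (-1))).const_mul hh.le (1 / 2 : ℂ))
    have := ((ha.mul hh ha.conj).mul hh hv).const_mul hh.le (μ : ℂ)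
    refine this.mono (le_of_eq ?_)
    rw [Complex.norm_real, Real.norm_eq_abs]
    norm_num
    ring
  · rw [alNonlinearity_eq, latticeDiff_const_mul, norm_mul, Complex.norm_real, Real.norm_eq_abs]
    have hv : ∀ n, ‖(1 / 2 : ℂ) * (a (n + 1) + a (n + -1))‖ ≤ M := by
      intro n
      rw [norm_mul]
      have := norm_add_le (a (n + 1)) (a (n + -1))
      norm_num
      linarith [ha (n + 1), ha (n + -1)]
    have b := norm_latticeDiff_mul_conj_mul_le (h := h) ha hv n
    have hd : ‖latticeDiff h (fun n => (1 / 2 : ℂ) * (a (n + 1) + a (n + -1))) n‖ ≤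
        ‖latticeDiff h a (n + 1)‖ + ‖latticeDiff h a (n - 1)‖ := by
      rw [latticeDiff_const_mul, latticeDiff_add, latticeDiff_shift, latticeDiff_shift, norm_mul]
      simp only [← sub_eq_add_neg]
      have := norm_add_le (latticeDiff h a (n + 1)) (latticeDiff h a (n - 1))
      norm_num
      linarith [norm_nonneg (latticeDiff h a (n + 1)), norm_nonneg (latticeDiff h a (n - 1))]
    calc _ ≤ |μ| * (M ^ 2 * (2 * ‖latticeDiff h a n‖ +
          (‖latticeDiff h a (n + 1)‖ + ‖latticeDiff h a (n - 1)‖))) := by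
          gcongr; exact b.trans (by gcongr)
      _ = 196 * |μ| * M ^ 2 * (2 / 196 * ‖latticeDiff h a n‖ +
          1 / 196 * ‖latticeDiff h a (n + 1)‖ + 1 / 196 * ‖latticeDiff h a (n - 1)‖) := by ring
      _ ≤ _ := by
        refine mul_le_mul_of_nonneg_left ?_ (by positivity)
        linarith [norm_nonneg (latticeDiff h a n), norm_nonneg (latticeDiff h a (n - 1)),
          norm_nonneg (latticeDiff h a (n + 1))]

/-- For fixed mesh size, a bounded solution stays in the discrete Zhidkov space. -/
theorem exists_zhidkovLe_of_flow {κ h τ c W : ℝ} (hh : 0 < h) {N : (ℤ → ℂ) → ℤ → ℂ}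
    (hN : IsTameCubic N c) {u : ℝ → ℤ → ℂ}
    (hu : LatticeFlow κ (fun t n => Complex.I * N (u t) n) 0 τ u)
    (h0 : LatticeL2Le h (latticeDiff h (u 0)) W) :
    ∃ S, 0 ≤ S ∧ ∀ t ∈ Icc 0 τ, ZhidkovLe h (u t) S := by
  obtain ⟨M, hM⟩ := hu.bdd
  have hK : 0 ≤ c * M ^ 2 := mul_nonneg hN.nonneg (sq_nonneg M)
  set A := Real.exp (3 * (c * M ^ 2) * τ) * W with hAdef
  -- The forcing of the first difference quotient is controlled by its neighbouring values with `K =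
  -- c * M ^ 2`, so `l2_le` applies with `g = 0`.
  have key : ∀ t ∈ Icc 0 τ, LatticeL2Le h (latticeDiff h (u t)) A := by
    intro t ht
    have := (hu.latticeDiff h).l2_le hh hK (g := fun _ _ => 0) (G := 0)
      (fun s hs n => ?_) le_rfl (fun _ _ => LatticeL2Le.zero h) h0 ht
    · refine this.mono ?_
      have hW := h0.nonneg
      rw [mul_zero, add_zero, sub_zero, hAdef]
      gcongr
      exact ht.2
    · rw [latticeDiff_const_mul, norm_mul, Complex.norm_I, one_mul, norm_zero, zero_add]
      exact hN.norm_diff_le (hM s (Ioo_subset_Icc_self hs)) n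
  by_cases hτ : 0 ≤ τ
  · have m0 : (0 : ℝ) ∈ Icc 0 τ := ⟨le_rfl, hτ⟩
    have hM0 : 0 ≤ M := (norm_nonneg _).trans (hM 0 m0 0)
    have hA : 0 ≤ A := (key 0 m0).nonneg
    have hA1 : 0 ≤ h⁻¹ * (A + A) := by positivity
    set A1 := h⁻¹ * (A + A)
    have hA2 : 0 ≤ h⁻¹ * (A1 + A1) := by positivity
    set A2 := h⁻¹ * (A1 + A1)
    refine ⟨M + A + A1 + A2, by positivity, fun t ht => ?_⟩
    have k1 := key t ht
    have k2 := k1.latticeDiff hh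
    have k3 := k2.latticeDiff hh
    exact ⟨fun n => (hM t ht n).trans (by linarith), k1.mono (by linarith), k2.mono (by linarith),
      k3.mono (by linarith)⟩
  · exact ⟨0, le_rfl, fun t ht => absurd (ht.1.trans ht.2) hτ⟩

/-- A priori bound in the discrete Zhidkov space on a time interval independent of the mesh. -/
theorem zhidkovLe_two_mul {h τ c R T : ℝ} (hh : 0 < h) {N : (ℤ → ℂ) → ℤ → ℂ}
    (hN : IsTameCubic N c) {u : ℝ → ℤ → ℂ}
    (hu : LatticeFlow (h ^ 2)⁻¹ (fun t n => Complex.I * N (u t) n) 0 τ u)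
    (hR : 0 < R) (h0 : ZhidkovLe h (u 0) R)
    (hT : T * (c * (3 * R) ^ 3 + 2 * (3 * R)) ≤ R) {t : ℝ} (ht : t ∈ Icc 0 (min T τ)) :
    ZhidkovLe h (u t) (2 * R) := by
  obtain ⟨S, hS, hSu⟩ := exists_zhidkovLe_of_flow hh hN hu h0.diff1
  have hc := hN.nonneg
  have grow : ∀ s₀ s₁ S₀ S', 0 ≤ s₀ → s₀ ≤ s₁ → s₁ ≤ τ → 0 ≤ S' →
      (∀ s ∈ Ioo s₀ s₁, ZhidkovLe h (u s) S') → ZhidkovLe h (u s₀) S₀ →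
      ZhidkovLe h (u s₁) (S₀ + (s₁ - s₀) * (c * S' ^ 3 + 2 * S')) := by
    intro s₀ s₁ S₀ S' h1 h2 h3 h4 h5 h6
    refine (hu.restrict h1 h3).zhidkovLe hh (by positivity) h4 (fun s hs => ?_) h5 h6
      (right_mem_Icc.2 h2)
    have := (hN.zhidkovLe hh (h5 s hs)).const_mul hh.le Complex.I
    rwa [Complex.norm_I, one_mul] at this
  -- The non-uniform bound `S` supplies a time step `δ` over which the norm grows by at most `R`. It
  -- may depend on `h`, since only the number of steps is affected.
  set L := c * S ^ 3 + 2 * S + 1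
  have hL : 0 < L := by positivity
  set δ := R / L
  have hδ : 0 < δ := by positivity
  have hδL : δ * L = R := div_mul_cancel₀ _ hL.ne'
  have step : ∀ k : ℕ, ∀ t ∈ Icc 0 (min T τ), t ≤ k * δ → ZhidkovLe h (u t) (2 * R) := by
    intro k
    induction k with
    | zero =>
      intro t ht htk
      have : t = 0 := le_antisymm (by simpa using htk) ht.1
      rw [this]
      exact h0.mono (by linarith)
    | succ k ih =>
      intro t ht htk
      have tT := ht.2.trans (min_le_left T τ)
      have tτ := ht.2.trans (min_le_right T τ)
      -- Bootstrap: one more step raises `2 * R` to at most `3 * R`, and growth from time 0 under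
      -- the bound `3 * R` brings it back to `2 * R` by the choice of `T`.
      have h3R : ∀ s ∈ Ioo 0 t, ZhidkovLe h (u s) (3 * R) := by
        intro s hs
        have sm : s ≤ min T τ := hs.2.le.trans ht.2
        rcases le_total s (k * δ) with hsk | hsk
        · exact (ih s ⟨hs.1.le, sm⟩ hsk).mono (by linarith)
        · have k0 : 0 ≤ k * δ := by positivity
          refine (grow (k * δ) s (2 * R) S k0 hsk (sm.trans (min_le_right _ _)) hS
            (fun r hr => hSu r ⟨k0.trans hr.1.le, hr.2.le.trans (sm.trans (min_le_right _ _))⟩)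
            (ih _ ⟨k0, hsk.trans sm⟩ le_rfl)).mono ?_
          have i1 : s - k * δ ≤ δ := by
            have := hs.2.le.trans htk
            push_cast at this; linarith
          have i2 : (s - k * δ) * (c * S ^ 3 + 2 * S) ≤ δ * L := by
            gcongr
            exact (lt_add_one _).le
          linarith
      refine (grow 0 t R (3 * R) le_rfl ht.1 tτ (by positivity) h3R h0).mono ?_
      have : (t - 0) * (c * (3 * R) ^ 3 + 2 * (3 * R)) ≤
          T * (c * (3 * R) ^ 3 + 2 * (3 * R)) := by
        gcongr; linarith
      linarith
  obtain ⟨k, hk⟩ := exists_nat_gt (t / δ)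
  exact step k t ht ((div_lt_iff₀ hδ).1 hk).le

/-! ### Comparison of the two solutions. -/

theorem alNonlinearity_sub_dnlsNonlinearity {h : ℝ} (hh : h ≠ 0) (μ : ℝ) (a b : ℤ → ℂ) (n : ℤ) :
    alNonlinearity μ a n - dnlsNonlinearity μ b n =
      (μ / 2 : ℂ) * (a n * starRingEnd ℂ (a n) *
        ((h : ℂ) ^ 2 * latticeDiff h (latticeDiff h a) (n + -1))) +
      (μ : ℂ) * (a n * starRingEnd ℂ (a n) * (a n - b n) +
        a n * b n * starRingEnd ℂ (a n - b n) + starRingEnd ℂ (b n) * b n * (a n - b n)) := by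
  rw [← discreteLaplacian_eq hh, alNonlinearity_eq, dnlsNonlinearity_eq]
  simp only [discreteLaplacian, map_sub, ← sub_eq_add_neg]
  ring

section Difference

variable {h μ S : ℝ} {a b : ℤ → ℂ}

/-- Measuring the consistency error in `H¹` takes the second and third difference quotients in `L²`,
hence the three derivatives required of the data. -/
theorem sobolevLe_consistency (hh : 0 < h) (ha : ZhidkovLe h a S) :
    SobolevLe h (fun n => (μ / 2 : ℂ) * (a n * starRingEnd ℂ (a n) *
      ((h : ℂ) ^ 2 * latticeDiff h (latticeDiff h a) (n + -1)))) (21 * |μ| * S ^ 3 * h ^ 2) := by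
  have h2 : SobolevLe h (latticeDiff h (latticeDiff h a)) S := ⟨ha.diff2, ha.diff3⟩
  refine (SobolevLe.const_mul hh.le (μ / 2 : ℂ) (SobolevLe.zhidkov_mul hh (ha.mul hh ha.conj)
    ((h2.shift (-1)).const_mul hh.le ((h : ℂ) ^ 2)))).mono (le_of_eq ?_)
  simp
  ring

theorem sobolevLe_nonlinear_difference (hh : 0 < h) (ha : ZhidkovLe h a S) (hb : ZhidkovLe h b S)
    {Φ : ℝ} (hab : SobolevLe h (fun n => a n - b n) Φ) :
    SobolevLe h (fun n => (μ : ℂ) * (a n * starRingEnd ℂ (a n) * (a n - b n) +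
        a n * b n * starRingEnd ℂ (a n - b n) + starRingEnd ℂ (b n) * b n * (a n - b n)))
      (126 * |μ| * S ^ 2 * Φ) := by
  refine ((((SobolevLe.zhidkov_mul hh (ha.mul hh ha.conj) hab).add hh.le
    (SobolevLe.zhidkov_mul hh (ha.mul hh hb) hab.conj)).add hh.le
    (SobolevLe.zhidkov_mul hh (hb.conj.mul hh hb) hab)).const_mul hh.le (μ : ℂ)).mono (le_of_eq ?_)
  rw [Complex.norm_real, Real.norm_eq_abs]
  ring

theorem norm_nonlinear_difference_le (ha : ∀ n, ‖a n‖ ≤ S) (hb : ∀ n, ‖b n‖ ≤ S) (n : ℤ) :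
    ‖(μ : ℂ) * (a n * starRingEnd ℂ (a n) * (a n - b n) +
        a n * b n * starRingEnd ℂ (a n - b n) + starRingEnd ℂ (b n) * b n * (a n - b n))‖ ≤
      3 * |μ| * S ^ 2 * ‖a n - b n‖ := by
  have hS : 0 ≤ S := (norm_nonneg _).trans (ha 0)
  rw [norm_mul, Complex.norm_real, Real.norm_eq_abs]
  have key : ∀ x y z : ℂ, ‖x‖ ≤ S → ‖y‖ ≤ S → ‖x * y * z‖ ≤ S * S * ‖z‖ := by
    intro x y z hx hy
    rw [norm_mul, norm_mul]
    gcongr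
  have b1 := key (a n) (starRingEnd ℂ (a n)) (a n - b n) (ha n) (by simpa using ha n)
  have b2 := key (a n) (b n) (starRingEnd ℂ (a n - b n)) (ha n) (hb n)
  have b3 := key (starRingEnd ℂ (b n)) (b n) (a n - b n) (by simpa using hb n) (hb n)
  rw [RCLike.norm_conj] at b2
  calc _ ≤ |μ| * (S * S * ‖a n - b n‖ + S * S * ‖a n - b n‖ + S * S * ‖a n - b n‖) := by
        gcongr
        exact norm_add₃_le.trans (by linarith)
    _ = _ := by ring

end Difference

/-- If two solutions of the Ablowitz-Ladik and the DNLS equations with the same initial data are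
bounded in the discrete Zhidkov space, they differ by `O(h² t)`. -/
theorem norm_sub_le_of_zhidkovLe {h μ S t : ℝ} (hh : 0 < h) (hS : 0 ≤ S) {u U : ℝ → ℤ → ℂ}
    (hu : LatticeFlow (h ^ 2)⁻¹ (fun t n => Complex.I * alNonlinearity μ (u t) n) 0 t u)
    (hU : LatticeFlow (h ^ 2)⁻¹ (fun t n => Complex.I * dnlsNonlinearity μ (U t) n) 0 t U)
    (h0 : u 0 = U 0) (huS : ∀ s ∈ Icc 0 t, ZhidkovLe h (u s) S)
    (hUS : ∀ s ∈ Icc 0 t, ZhidkovLe h (U s) S) (ht : 0 ≤ t)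
    (htS : t * (126 * |μ| * S ^ 2) ≤ 1 / 2) (n : ℤ) :
    ‖u t n - U t n‖ ≤ 84 * |μ| * S ^ 3 * h ^ 2 * t := by
  have hφ := hu.sub hU
  simp only [← mul_sub, alNonlinearity_sub_dnlsNonlinearity hh.ne'] at hφ
  set α := 21 * |μ| * S ^ 3 * h ^ 2 with hα
  have hα0 : 0 ≤ α := by positivity
  have hz : (fun n => u 0 n - U 0 n) = fun _ => (0 : ℂ) := by funext n; rw [h0, sub_self]
  have hz0 : LatticeL2Le h (fun n => u 0 n - U 0 n) 0 := by
    rw [hz]; exact LatticeL2Le.zero h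
  have hzs : SobolevLe h (fun n => u 0 n - U 0 n) 0 := by
    refine ⟨hz0, ?_⟩
    have e : latticeDiff h (fun _ => (0 : ℂ)) = fun _ => 0 := by funext n; simp [latticeDiff]
    rw [hz, e]; exact LatticeL2Le.zero h
  -- A finite `H¹` bound, possibly bad in `h`, is needed to start the iteration below. It comes from
  -- the `L²` estimate and the inverse inequality.
  have crude : ∃ Φ, 0 ≤ Φ ∧ ∀ s ∈ Icc 0 t, SobolevLe h (fun n => u s n - U s n) Φ := by
    set K := 3 * |μ| * S ^ 2 with hK
    have hK0 : 0 ≤ K := by positivity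
    set A := Real.exp (3 * K * t) * (t * α) with hA
    have hA0 : 0 ≤ A := by positivity
    have hA1 : 0 ≤ h⁻¹ * (A + A) := by positivity
    refine ⟨A + h⁻¹ * (A + A), by positivity, fun s hs => ?_⟩
    have k0 := hφ.l2_le hh hK0 (g := fun s n => Complex.I * ((μ / 2 : ℂ) *
        (u s n * starRingEnd ℂ (u s n) *
        ((h : ℂ) ^ 2 * latticeDiff h (latticeDiff h (u s)) (n + -1))))) (G := α)
      (fun r hr n => ?_) hα0 (fun r hr => ?_) hz0 hs
    · have k1 : LatticeL2Le h (fun n => u s n - U s n) A := by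
        refine k0.mono ?_
        rw [zero_add, sub_zero, hA]
        have hs0 := hs.1
        have hs1 := hs.2
        gcongr
      exact ⟨k1.mono (by linarith), (k1.latticeDiff hh).mono (by linarith)⟩
    · have hr' := Ioo_subset_Icc_self hr
      rw [mul_add]
      refine (norm_add_le _ _).trans (add_le_add le_rfl ?_)
      rw [norm_mul, Complex.norm_I, one_mul]
      refine (norm_nonlinear_difference_le (huS r hr').norm_le (hUS r hr').norm_le n).trans ?_
      gcongr
      linarith [norm_nonneg (u r (n - 1) - U r (n - 1)), norm_nonneg (u r (n + 1) - U r (n + 1))]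
    · have := ((sobolevLe_consistency (μ := μ) hh (huS r (Ioo_subset_Icc_self hr))).const_mul hh.le
        Complex.I).diff0
      rwa [Complex.norm_I, one_mul] at this
  obtain ⟨Φ, hΦ, hcr⟩ := crude
  -- By `htS`, an `H¹` bound `Ψ` improves to `t * α + Ψ / 2`. The fixed point of this map is `2 * (t
  -- * α)`, and the crude bound is halved away.
  have iter : ∀ k : ℕ, ∀ s ∈ Icc 0 t,
      SobolevLe h (fun n => u s n - U s n) (2 * (t * α) + Φ / 2 ^ k) := by
    intro k
    induction k with
    | zero =>
      intro s hs
      refine (hcr s hs).mono ?_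
      rw [pow_zero, div_one]
      have : 0 ≤ t * α := by positivity
      linarith
    | succ k ih =>
      intro s hs
      set Ψ := 2 * (t * α) + Φ / 2 ^ k with hΨ
      have hΨ0 : 0 ≤ Ψ := by positivity
      have hF : 0 ≤ α + 126 * |μ| * S ^ 2 * Ψ := by positivity
      refine (hφ.sobolevLe hh hF (fun r hr => ?_) hzs hs).mono ?_
      · have hr' := Ioo_subset_Icc_self hr
        have := ((sobolevLe_consistency (μ := μ) hh (huS r hr')).add hh.le
          (sobolevLe_nonlinear_difference (μ := μ) hh (huS r hr') (hUS r hr') (ih r hr'))).const_mul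
          hh.le Complex.I
        rwa [Complex.norm_I, one_mul] at this
      · rw [zero_add, sub_zero]
        calc s * (α + 126 * |μ| * S ^ 2 * Ψ) ≤ t * (α + 126 * |μ| * S ^ 2 * Ψ) := by
              gcongr; exact hs.2
          _ = t * α + t * (126 * |μ| * S ^ 2) * Ψ := by ring
          _ ≤ t * α + 1 / 2 * Ψ := by gcongr
          _ = _ := by rw [hΨ, pow_succ]; field_simp; ring
  have lim : Tendsto (fun k : ℕ => 2 * (2 * (t * α) + Φ / 2 ^ k)) atTop
      (𝓝 (2 * (2 * (t * α) + 0))) := by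
    refine (tendsto_const_nhds.add ?_).const_mul 2
    have h1 := (tendsto_pow_atTop_nhds_zero_of_lt_one (r := (1 / 2 : ℝ)) (by norm_num)
      (by norm_num)).const_mul Φ
    rw [mul_zero] at h1
    refine h1.congr fun k => ?_
    rw [one_div, inv_pow, div_eq_mul_inv]
  have fin := ge_of_tendsto' lim fun k => (iter k t (right_mem_Icc.2 ht)).norm_le hh n
  -- The Sobolev embedding doubles the limit to `4 * (t * α)`, and `4 * 21 = 84`.
  calc _ ≤ _ := fin
    _ = _ := by rw [hα]; ring

/-! ### Choice of constants and conclusion. -/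

theorem theorem5p1 (μ : ℝ) (u₀ : ℝ → ℂ) (hu₀ : ContDiff ℝ 3 u₀)
    (hbdd : ∃ B : ℝ, ∀ x : ℝ, ‖u₀ x‖ ≤ B)
    (hL2 : ∀ k : ℕ, 1 ≤ k → k ≤ 3 →
      MeasureTheory.MemLp (iteratedDeriv k u₀) 2 MeasureTheory.volume) :
    ∃ T : ℝ, 0 < T ∧ ∃ C : ℝ, 0 < C ∧
      ∀ h : ℝ, 0 < h → h ≤ 1 →
      ∀ x : ℤ → ℝ, (∀ n : ℤ, x n = x (n - 1) + h) →
      ∀ (τ : ℝ) (u U : ℝ → ℤ → ℂ),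
        IsALSolution μ h τ u → IsDNLSSolution μ h τ U →
        (∀ n : ℤ, u 0 n = u₀ (x n)) → (∀ n : ℤ, U 0 n = u₀ (x n)) →
        ∀ t ∈ Set.Icc 0 (min T τ),
          ∃ φ : lp (fun _ : ℤ => ℂ) ⊤,
            (∀ n : ℤ, φ n = u t n - U t n) ∧ ‖φ‖ ≤ C * h ^ 2 * t := by
  obtain ⟨R, hR, hsample⟩ := exists_zhidkovLe_sample hu₀ hbdd hL2
  set c := 196 * |μ| with hc
  have hc0 : 0 ≤ c := by positivity
  set L := c * (3 * R) ^ 3 + 2 * (3 * R) with hL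
  have hL0 : 0 < L := by positivity
  set β := 126 * |μ| * (2 * R) ^ 2 with hβ
  have hβ0 : 0 ≤ β := by positivity
  -- The first bound on `T` keeps both solutions below `2 * R`; the second makes the `H¹` estimate
  -- of the difference a contraction with factor `1/2`.
  set T := min (R / L) (1 / (2 * β + 1)) with hT
  have hTL : T * L ≤ R := by
    calc T * L ≤ R / L * L := by gcongr; exact min_le_left _ _
      _ = R := div_mul_cancel₀ _ hL0.ne'
  have hTβ : T * β ≤ 1 / 2 := by
    calc T * β ≤ 1 / (2 * β + 1) * β := by gcongr; exact min_le_right _ _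
      _ ≤ 1 / 2 := by rw [one_div_mul_eq_div, div_le_iff₀ (by positivity)]; linarith
  -- The summand 1 keeps `C` positive when `μ = 0`.
  refine ⟨T, by positivity, 84 * |μ| * (2 * R) ^ 3 + 1, by positivity, ?_⟩
  intro h hh _ x hx τ u U hu hU hu0 hU0 t ht
  have tτ := ht.2.trans (min_le_right T τ)
  have tT := ht.2.trans (min_le_left T τ)
  have fu := hu.latticeFlow
  have fU := hU.latticeFlow
  have eu : u 0 = fun n => u₀ (x n) := funext hu0
  have eU : U 0 = fun n => u₀ (x n) := funext hU0
  have zu : ZhidkovLe h (u 0) R := by rw [eu]; exact hsample h hh x hx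
  have zU : ZhidkovLe h (U 0) R := by rw [eU]; exact hsample h hh x hx
  have key : ∀ n, ‖u t n - U t n‖ ≤ (84 * |μ| * (2 * R) ^ 3 + 1) * h ^ 2 * t := by
    intro n
    refine (norm_sub_le_of_zhidkovLe hh (by positivity : 0 ≤ 2 * R) (fu.restrict le_rfl tτ)
      (fU.restrict le_rfl tτ) (eu.trans eU.symm)
      (fun s hs => zhidkovLe_two_mul hh (isTameCubic_al μ) fu hR zu hTL ⟨hs.1, hs.2.trans ht.2⟩)
      (fun s hs => zhidkovLe_two_mul hh (isTameCubic_dnls μ) fU hR zU hTL ⟨hs.1, hs.2.trans ht.2⟩)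
      ht.1 ((mul_le_mul_of_nonneg_right tT hβ0).trans hTβ) n).trans ?_
    have := ht.1
    gcongr
    linarith
  have mem : Memℓp (fun n : ℤ => u t n - U t n) ⊤ := by
    refine memℓp_infty ⟨(84 * |μ| * (2 * R) ^ 3 + 1) * h ^ 2 * t, ?_⟩
    rintro _ ⟨n, rfl⟩
    exact key n
  refine ⟨⟨_, mem⟩, fun n => rfl, ?_⟩
  have := ht.1
  exact lp.norm_le_of_forall_le (by positivity) key
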